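/- \textbf{Setting.} For each $n$ let $p=p_n$, let $P=P_n$ be a probability distribution on $\mathbb R^p$ with mean zero and covariance matrix $\Sigma_0$, and let $X$ be the $n\times p$ matrix whose rows $X^1,\dots,X^n$ are independent with law $P$. Put $\Theta_0:=\Sigma_0^{-1}$, $R_0:=W_0^{-1}\Sigma_0W_0^{-1}$ with $W_0^2:=\mathrm{diag}(\Sigma_0)$, $K_0:=R_0^{-1}$; and $\hat\Sigma:=X^TX/n$, $\hat W^2:=\mathrm{diag}(\hat\Sigma)$, $\hat R:=\hat W^{-1}\hat\Sigma\hat W^{-1}$. Write $\|A\|_\infty:=\max_{i,j}|A_{ij}|$ and $d:=\max_j\#\{i\ne j:(\Theta_0)_{ij}\ne0\}$. \textbf{Estimator.} Let $Z:=X\hat W^{-1}$ be the normalized data matrix, with columns $Z_1,\dots,Z_p$, and let $Z_{-j}$ be $Z$ without its $j$-th column. For $j=1,\dots,p$ let $$\hat\gamma_j\in\operatorname*{argmin}_{\gamma\in\mathbb R^{p-1}}\ \|Z_j-Z_{-j}\gamma\|_2/\sqrt n+2\lambda\|\gamma\|_1,\qquad \hat\tau_j:=\|Z_j-Z_{-j}\hat\gamma_j\|_2/\sqrt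 n,\qquad \tilde\tau_j^2:=\hat\tau_j^2+\lambda\hat\tau_j\|\hat\gamma_j\|_1 .$$ The normalized nodewise square-root Lasso $\hat\Theta_{\rm norm}$ is the $p\times p$ matrix whose $j$-th column has $j$-th entry $1/\tilde\tau_j^2$ and $k$-th entry $-\hat\gamma_{j,k}/\tilde\tau_j^2$ for $k\neq j$. \textbf{Proposition.} Let $L\ge1$ and $K>0$. There is a constant $c_0>0$, depending only on $L$ and $K$, such that the following holds for every constant $C$. Suppose that for all $n$ \begin{itemize} \item (bounded spectrum) $\Theta_0$ exists and $1/L\le\Lambda_{\min}(\Theta_0)\le\Lambda_{\max}(\Theta_0)\le L$; \item (sub-Gaussianity) $\mathbb E\exp(|\alpha^TX^i|^2/K^2)\le2$ for every $\alpha\in\mathbb R^p$ with $\|\alpha\|_2=1$ and every $i$; \end{itemize} that $\lambda\asymp\sqrt{\log p/n}$ in the sense that $c_0\sqrt{\log p/n}\le\lambda\le C\sqrt{\log p/n}$ for all large $n$; and that, as $n\to\infty$, $d=o(\sqrt n/\log p)$ and $\log p=o(n)$ (the latter follows from the former whenever $d\ge1$). Then, for every choice of the minimizers $\hat\gamma_j$,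 $$\hat\Theta_{\rm norm}+\hat\Theta_{\rm norm}^T-\hat\Theta_{\rm norm}^T\hat R\,\hat\Theta_{\rm norm}-K_0=-K_0(\hat R-R_0)K_0+\mathrm{rem},\qquad \|\mathrm{rem}\|_\infty=o_P(1/\sqrt n).$$ -/

import Mathlib

open MeasureTheory ProbabilityTheory Filter Asymptotics Topology

namespace NodewiseSqrtLasso

noncomputable section

/-- Covariance matrix `Σ₀` of a distribution `P` on `ℝᵖ`. -/
def covMatrix {p : ℕ} (P : Measure (Fin p → ℝ)) : Matrix (Fin p) (Fin p) ℝ :=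
  Matrix.of fun i j => cov[fun x => x i, fun x => x j; P]

/-- The diagonal matrix `W⁻¹`, where `W² = diag(S)`. -/
def invStd {p : ℕ} (S : Matrix (Fin p) (Fin p) ℝ) : Matrix (Fin p) (Fin p) ℝ :=
  Matrix.diagonal fun j => (√(S j j))⁻¹

/-- The correlation matrix `W⁻¹ S W⁻¹`, where `W² = diag(S)`. -/
def corrMatrix {p : ℕ} (S : Matrix (Fin p) (Fin p) ℝ) : Matrix (Fin p) (Fin p) ℝ :=
  invStd S * S * invStd S

/-- The precision matrix `Θ₀ = Σ₀⁻¹`. -/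
def precision {p : ℕ} (P : Measure (Fin p → ℝ)) : Matrix (Fin p) (Fin p) ℝ :=
  (covMatrix P)⁻¹

/-- The correlation matrix `R₀`. -/
def trueCorr {p : ℕ} (P : Measure (Fin p → ℝ)) : Matrix (Fin p) (Fin p) ℝ :=
  corrMatrix (covMatrix P)

/-- The inverse correlation matrix `K₀ = R₀⁻¹`. -/
def invCorr {p : ℕ} (P : Measure (Fin p → ℝ)) : Matrix (Fin p) (Fin p) ℝ :=
  (trueCorr P)⁻¹

/-- Bounded spectrum: `Θ₀ = Σ₀⁻¹` exists and all its eigenvalues lie in `[1/L, L]`. -/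
def BoundedSpectrum {p : ℕ} (P : Measure (Fin p → ℝ)) (L : ℝ) : Prop :=
  IsUnit (covMatrix P) ∧ spectrum ℝ (precision P) ⊆ Set.Icc (1 / L) L

/-- Sub-Gaussianity with constant `K`: `E exp(|αᵀX|²/K²) ≤ 2` for every Euclidean unit vector `α`. -/
def SubGaussianVector {p : ℕ} (P : Measure (Fin p → ℝ)) (K : ℝ) : Prop :=
  ∀ α : Fin p → ℝ, ∑ j, α j ^ 2 = 1 →
    Integrable (fun x => Real.exp (|∑ j, α j * x j| ^ 2 / K ^ 2)) P ∧
      ∫ x, Real.exp (|∑ j, α j * x j| ^ 2 / K ^ 2) ∂P ≤ 2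

/-- The maximum vertex degree: the largest number of non-zero off-diagonal entries in a column
of the precision matrix. -/
def maxDegree {p : ℕ} (P : Measure (Fin p → ℝ)) : ℕ :=
  Finset.univ.sup fun j : Fin p => Set.ncard {i : Fin p | i ≠ j ∧ precision P i j ≠ 0}

/-- The sample covariance matrix `Σ̂ = XᵀX/n` of an `n × p` data matrix. -/
def sampleCov {n p : ℕ} (X : Matrix (Fin n) (Fin p) ℝ) : Matrix (Fin p) (Fin p) ℝ :=
  (n : ℝ)⁻¹ • (X.transpose * X)

/-- The sample correlation matrix `R̂ = Ŵ⁻¹ Σ̂ Ŵ⁻¹`, where `Ŵ² = diag(Σ̂)`. -/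
def sampleCorr {n p : ℕ} (X : Matrix (Fin n) (Fin p) ℝ) : Matrix (Fin p) (Fin p) ℝ :=
  corrMatrix (sampleCov X)

/-- The normalized data matrix `X Ŵ⁻¹`; its sample covariance matrix is `R̂`. -/
def standardize {n p : ℕ} (X : Matrix (Fin n) (Fin p) ℝ) : Matrix (Fin n) (Fin p) ℝ :=
  X * invStd (sampleCov X)

/-- `‖Z_j - Z_{-j} γ‖₂ / √n`. At `γ = γ̂_j` this is the noise level `τ̂_j`. -/
def residualLevel {n p : ℕ} (Z : Matrix (Fin n) (Fin p) ℝ) (j : Fin p)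
    (γ : {k : Fin p // k ≠ j} → ℝ) : ℝ :=
  √(∑ i, (Z i j - ∑ k : {k : Fin p // k ≠ j}, Z i k.1 * γ k) ^ 2) / √(n : ℝ)

/-- The square-root Lasso objective `‖Z_j - Z_{-j} γ‖₂/√n + 2λ‖γ‖₁` for node `j`. -/
def objective {n p : ℕ} (lam : ℝ) (Z : Matrix (Fin n) (Fin p) ℝ) (j : Fin p)
    (γ : {k : Fin p // k ≠ j} → ℝ) : ℝ :=
  residualLevel Z j γ + 2 * lam * ∑ k, |γ k|

/-- `τ̃_j² = τ̂_j² + λ τ̂_j ‖γ‖₁`. -/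
def tauTildeSq {n p : ℕ} (lam : ℝ) (Z : Matrix (Fin n) (Fin p) ℝ) (j : Fin p)
    (γ : {k : Fin p // k ≠ j} → ℝ) : ℝ :=
  residualLevel Z j γ ^ 2 + lam * residualLevel Z j γ * ∑ k, |γ k|

/-- The matrix whose `j`-th column has `j`-th entry `1/τ̃_j²` and `k`-th entry `-γ_{j,k}/τ̃_j²`
for `k ≠ j`. -/
def nodewiseMatrix {n p : ℕ} (lam : ℝ) (Z : Matrix (Fin n) (Fin p) ℝ)
    (γ : (j : Fin p) → {k : Fin p // k ≠ j} → ℝ) : Matrix (Fin p) (Fin p) ℝ :=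
  Matrix.of fun k j =>
    if h : k = j then 1 / tauTildeSq lam Z j (γ j)
    else -(γ j ⟨k, h⟩) / tauTildeSq lam Z j (γ j)

/-- `Θ` is a normalized nodewise square-root Lasso estimate with tuning parameter `lam` from the
data matrix `X`: it is assembled from solutions of the `p` square-root Lasso problems for the
normalized data `X Ŵ⁻¹`. The penalty weights `√(diag R̂)` of the normalized columns all equal one,
so the `ℓ₁` penalty carries no weights. -/
def IsNormalizedNodewise {n p : ℕ} (lam : ℝ) (X : Matrix (Fin n) (Fin p) ℝ)
    (Θ : Matrix (Fin p) (Fin p) ℝ) : Prop :=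
  ∃ γ : (j : Fin p) → {k : Fin p // k ≠ j} → ℝ,
    (∀ j, IsMinOn (objective lam (standardize X) j) Set.univ (γ j)) ∧
      Θ = nodewiseMatrix lam (standardize X) γ

/-- The supremum norm `‖A‖_∞ = max_{i,j} |A_{ij}|`. -/
def supNorm {p : ℕ} (A : Matrix (Fin p) (Fin p) ℝ) : ℝ :=
  ⨆ ij : Fin p × Fin p, |A ij.1 ij.2|

/-- The remainder of the linear expansion of the de-biased estimator:
`rem = (Θ̂ + Θ̂ᵀ - Θ̂ᵀ R̂ Θ̂ - K₀) - (-K₀ (R̂ - R₀) K₀)`. -/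
def remainder {n p : ℕ} (P : Measure (Fin p → ℝ)) (X : Matrix (Fin n) (Fin p) ℝ)
    (Θ : Matrix (Fin p) (Fin p) ℝ) : Matrix (Fin p) (Fin p) ℝ :=
  (Θ + Θ.transpose - Θ.transpose * sampleCorr X * Θ - invCorr P)
    - (-(invCorr P * (sampleCorr X - trueCorr P) * invCorr P))

end

end NodewiseSqrtLasso

/-! Write `A = R̂`, `K = K₀`, `T = Θ̂_norm`, `ρ = L²`. Since `R₀ K = 1`, the remainder equals
`-(T-K)ᵀ(AK-1) - (AK-1)ᵀ(T-K) - (T-K)ᵀA(T-K)` (`remainder_identity`). It is therefore controlled by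
the entries of `AK-1`, the ℓ₁ errors of the columns of `T` and their prediction errors. These have
orders `η`, `sη`, `sη²` with `s = d+1` and `η ≍ √(log p / n)`, so the remainder has order `s log p /
n`, which is `o(1/√n)` when `d ≥ 1`.

The noise bound comes from Bernstein's inequality for bilinear forms of `Σ̂` and a union bound;
`abs_corrMatrix_mul_inv_sub_one_le` carries it to the correlation scale without a factor `√s`. The
rest is deterministic (`ApproxInverse`). Node `j` minimizes `√(wᵀAw) + 2λ‖w‖₁` over `w_j = 1`, with
target `K_j / K_jj`. The basic inequality, the cone condition and the restricted eigenvalue bound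
give the rates (`column_rates`); `τ̃_j²` then estimates `1/K_jj`, which yields the columns of `T`
(`column_error`).

Two cases escape this scheme. If `p` stays bounded, `λ` need not dominate the noise and a failure
probability of order `1/p` does not vanish. Then all coordinates serve as support, compatibility is
plain Cauchy–Schwarz, and the noise level is `M/√n` with `M` depending on the tolerated probability.
If `d = 0`, the hypotheses give only `log p = o(n)`, and `η²` may exceed `1/√n`. Then the cone
condition over an empty support forces `γ̂_j = 0`, and the remainder vanishes exactly. -/

namespace NodewiseSqrtLasso

/-! ### Exponential moments and Bernstein's inequality. -/

theorem exp_le_one_add_add_sq_mul_exp_abs (y : ℝ) :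
    Real.exp y ≤ 1 + y + y ^ 2 * Real.exp |y| := by
  have h1 : Real.exp y * (1 - y) ≤ 1 := by
    have := Real.add_one_le_exp (-y)
    calc Real.exp y * (1 - y) ≤ Real.exp y * Real.exp (-y) := by
          gcongr; linarith
      _ = 1 := by rw [← Real.exp_add]; simp
  rcases le_total 0 y with hy | hy
  · rw [abs_of_nonneg hy]
    nlinarith [Real.exp_pos y]
  · have h2 := Real.one_le_exp (abs_nonneg y)
    have h3 := Real.add_one_le_exp y
    nlinarith [sq_nonneg y]

theorem sq_le_exp_half {a y : ℝ} (ha : 0 < a) :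
    y ^ 2 ≤ 8 / a ^ 2 * Real.exp (a * |y| / 2) := by
  have h := Real.quadratic_le_exp_of_nonneg (x := a * |y| / 2) (by positivity)
  rw [div_mul_eq_mul_div, le_div_iff₀ (by positivity)]
  have : 0 ≤ a * |y| / 2 := by positivity
  nlinarith [sq_abs y]

theorem integrable_exp_mul_sum_of_iIndepFun {ι Ω : Type*} [MeasurableSpace Ω] {μ : Measure Ω}
    {X : ι → Ω → ℝ} {t : ℝ} (h_indep : iIndepFun X μ) (h_meas : ∀ i, AEMeasurable (X i) μ)
    (h_int : ∀ i, Integrable (fun ω => Real.exp (t * X i ω)) μ) (s : Finset ι) :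
    Integrable (fun ω => Real.exp (t * (∑ i ∈ s, X i) ω)) μ := by
  classical
  have := h_indep.isProbabilityMeasure
  induction s using Finset.induction_on with
  | empty => simp
  | insert i s hi ih =>
    rw [Finset.sum_insert hi]
    exact (h_indep.indepFun_finsetSum_of_notMem₀ h_meas hi).symm.integrable_exp_mul_add
      (h_int i) ih

section ExponentialTail

variable {E : Type*} [MeasurableSpace E] {P : Measure E} {f : E → ℝ} {a : ℝ}

theorem integrable_of_integrable_exp_abs (hf : Measurable f) (ha : 0 < a)
    (hint : Integrable (fun x => Real.exp (a * |f x|)) P) : Integrable f P := by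
  refine Integrable.mono' (hint.const_mul a⁻¹) hf.aestronglyMeasurable (ae_of_all _ fun x => ?_)
  rw [Real.norm_eq_abs, inv_mul_eq_div, le_div_iff₀ ha]
  have := Real.add_one_le_exp (a * |f x|)
  linarith

theorem integrable_exp_mul_of_abs_le (hf : Measurable f)
    (hint : Integrable (fun x => Real.exp (a * |f x|)) P) {s : ℝ} (hs : |s| ≤ a) :
    Integrable (fun x => Real.exp (s * f x)) P := by
  refine Integrable.mono' hint (by fun_prop) (ae_of_all _ fun x => ?_)
  rw [Real.norm_eq_abs, abs_of_pos (Real.exp_pos _), Real.exp_le_exp]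
  calc s * f x ≤ |s * f x| := le_abs_self _
    _ = |s| * |f x| := abs_mul _ _
    _ ≤ a * |f x| := by gcongr

/-- A variable with `E exp (a |f|) ≤ 2` has a moment generating function of Bernstein type. -/
theorem integral_exp_mul_le [IsProbabilityMeasure P] (hf : Measurable f) (ha : 0 < a)
    (hint : Integrable (fun x => Real.exp (a * |f x|)) P)
    (h2 : ∫ x, Real.exp (a * |f x|) ∂P ≤ 2) {s : ℝ} (hs : |s| ≤ a / 2) :
    ∫ x, Real.exp (s * f x) ∂P ≤ Real.exp (s * ∫ x, f x ∂P + 16 * s ^ 2 / a ^ 2) := by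
  have hfi := integrable_of_integrable_exp_abs hf ha hint
  have hpt : ∀ x, Real.exp (s * f x) ≤
      1 + s * f x + s ^ 2 * (8 / a ^ 2) * Real.exp (a * |f x|) := by
    intro x
    refine (exp_le_one_add_add_sq_mul_exp_abs _).trans ?_
    have e1 : Real.exp |s * f x| ≤ Real.exp (a * |f x| / 2) := by
      rw [abs_mul]
      gcongr
      nlinarith [abs_nonneg (f x)]
    have e2 := sq_le_exp_half (y := f x) ha
    -- Half of the exponent pays for the factor `f²`, the other half for `|s f| ≤ a |f| / 2`.
    have e3 : Real.exp (a * |f x|) = Real.exp (a * |f x| / 2) * Real.exp (a * |f x| / 2) := by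
      rw [← Real.exp_add]; ring_nf
    rw [e3]
    have : (s * f x) ^ 2 * Real.exp |s * f x| ≤
        s ^ 2 * (8 / a ^ 2 * Real.exp (a * |f x| / 2)) * Real.exp (a * |f x| / 2) := by
      rw [mul_pow]
      gcongr
    linarith
  calc ∫ x, Real.exp (s * f x) ∂P
      ≤ ∫ x, (1 + s * f x + s ^ 2 * (8 / a ^ 2) * Real.exp (a * |f x|)) ∂P := by
        refine integral_mono (integrable_exp_mul_of_abs_le hf hint (by linarith)) ?_ hpt
        exact ((integrable_const _).add (hfi.const_mul _)).add (hint.const_mul _)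
    _ = 1 + s * ∫ x, f x ∂P + s ^ 2 * (8 / a ^ 2) * ∫ x, Real.exp (a * |f x|) ∂P := by
        have hadd : Integrable (fun x => 1 + s * f x) P :=
          (integrable_const _).add (hfi.const_mul _)
        rw [integral_add hadd (hint.const_mul _), integral_add (integrable_const _) (hfi.const_mul _), integral_const_mul,
          integral_const_mul]
        simp
    _ ≤ 1 + s * ∫ x, f x ∂P + s ^ 2 * (8 / a ^ 2) * 2 := by gcongr
    _ = (s * ∫ x, f x ∂P + 16 * s ^ 2 / a ^ 2) + 1 := by ring
    _ ≤ _ := Real.add_one_le_exp _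

variable {Ω : Type*} [MeasurableSpace Ω] {μ : Measure Ω} {n : ℕ} {X : Fin n → Ω → E}

theorem measureReal_le_sum_le [IsProbabilityMeasure P] (hf : Measurable f) (ha : 0 < a)
    (hint : Integrable (fun x => Real.exp (a * |f x|)) P)
    (h2 : ∫ x, Real.exp (a * |f x|) ∂P ≤ 2)
    (hX : ∀ i, HasLaw (X i) P μ) (hindep : iIndepFun X μ)
    {t : ℝ} (ht0 : 0 ≤ t) (ht : t ≤ 16 / a) :
    μ.real {ω | n * t ≤ ∑ i, f (X i ω) - n * ∫ x, f x ∂P} ≤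
      Real.exp (-(n * (a ^ 2 * t ^ 2 / 64))) := by
  have := hindep.isProbabilityMeasure
  set m := ∫ x, f x ∂P
  -- The minimizer of the Chernoff exponent `-s t + 16 s² / a²`; the condition `s ≤ a / 2` is
  -- exactly `t ≤ 16 / a`.
  set s := a ^ 2 * t / 32 with hs
  have hs0 : 0 ≤ s := by positivity
  have hsa : |s| ≤ a / 2 := by
    rw [abs_of_nonneg hs0, hs]
    have : t * a ≤ 16 := by rwa [le_div_iff₀ ha] at ht
    nlinarith
  have hY : iIndepFun (fun i ω => f (X i ω)) μ := hindep.comp (fun _ => f) (fun _ => hf)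
  have hYm : ∀ i, AEMeasurable (fun ω => f (X i ω)) μ :=
    fun i => hf.comp_aemeasurable (hX i).aemeasurable
  have hexp := integrable_exp_mul_of_abs_le hf hint (s := s) (by linarith)
  have hYint : ∀ i, Integrable (fun ω => Real.exp (s * f (X i ω))) μ := by
    intro i
    have := (hX i).map_eq ▸ hexp
    exact this.comp_aemeasurable (hX i).aemeasurable
  have hmgf : ∀ i, mgf (fun ω => f (X i ω)) μ s ≤ Real.exp (s * m + 16 * s ^ 2 / a ^ 2) := by
    intro i
    have : mgf (fun ω => f (X i ω)) μ s = ∫ x, Real.exp (s * f x) ∂P :=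
      (hX i).integral_comp (f := fun x => Real.exp (s * f x)) hexp.aestronglyMeasurable
    rw [this]
    exact integral_exp_mul_le hf ha hint h2 hsa
  have hsumint : Integrable (fun ω => Real.exp (s * (∑ i, fun ω => f (X i ω)) ω)) μ :=
    integrable_exp_mul_sum_of_iIndepFun hY hYm hYint _
  have hch := measure_ge_le_exp_mul_mgf (n * t + n * m) hs0 hsumint
  rw [hY.mgf_sum₀ hYm] at hch
  have hset : {ω | n * t ≤ ∑ i, f (X i ω) - n * m} =
      {ω | n * t + n * m ≤ (∑ i, fun ω => f (X i ω)) ω} := by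
    ext ω
    simp only [Set.mem_ofPred_eq, Finset.sum_apply]
    constructor <;> intro h <;> linarith
  rw [hset]
  refine hch.trans ?_
  calc Real.exp (-s * (n * t + n * m)) * ∏ i, mgf (fun ω => f (X i ω)) μ s
      ≤ Real.exp (-s * (n * t + n * m)) *
          ∏ _i : Fin n, Real.exp (s * m + 16 * s ^ 2 / a ^ 2) := by
        gcongr
        · intro i _; exact mgf_nonneg
        · exact hmgf _
    _ = Real.exp (-(n * (a ^ 2 * t ^ 2 / 64))) := by
        rw [Finset.prod_const, Finset.card_univ, Fintype.card_fin, ← Real.exp_nat_mul,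
          ← Real.exp_add]
        congr 1
        rw [hs]
        field_simp
        ring

/-- Bernstein's inequality for the empirical mean of `f`. -/
theorem measureReal_le_abs_sum_le [IsProbabilityMeasure P] (hf : Measurable f) (ha : 0 < a)
    (hint : Integrable (fun x => Real.exp (a * |f x|)) P)
    (h2 : ∫ x, Real.exp (a * |f x|) ∂P ≤ 2)
    (hX : ∀ i, HasLaw (X i) P μ) (hindep : iIndepFun X μ)
    {t : ℝ} (ht0 : 0 ≤ t) (ht : t ≤ 16 / a) :
    μ.real {ω | n * t ≤ |∑ i, f (X i ω) - n * ∫ x, f x ∂P|} ≤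
      2 * Real.exp (-(n * (a ^ 2 * t ^ 2 / 64))) := by
  have := hindep.isProbabilityMeasure
  have h1 := measureReal_le_sum_le hf ha hint h2 hX hindep ht0 ht
  have h3 := measureReal_le_sum_le (f := fun x => -f x) hf.neg ha (by simpa using hint)
    (by simpa using h2) hX hindep ht0 ht
  refine (measureReal_mono ?_).trans ((measureReal_union_le _ _).trans (add_le_add h1 h3))
    |>.trans_eq (two_mul _).symm
  intro ω hω
  rcases le_abs.1 (Set.mem_ofPred_eq ▸ hω) with h | h
  · exact Or.inl h
  · right
    simp only [Set.mem_ofPred_eq, integral_neg, Finset.sum_neg_distrib]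
    linarith

end ExponentialTail

/-! ### Concentration of bilinear forms of the sample covariance. -/

section SubGaussian

variable {p : ℕ} {P : Measure (Fin p → ℝ)} {K : ℝ}

theorem exp_abs_mul_le (a x y : ℝ) (ha : 0 ≤ a) :
    Real.exp (a * |x * y|) ≤ (Real.exp (|x| ^ 2 * a) + Real.exp (|y| ^ 2 * a)) / 2 := by
  have h1 : Real.exp (a * |x * y|) ≤ Real.exp (|x| ^ 2 * a / 2) * Real.exp (|y| ^ 2 * a / 2) := by
    rw [← Real.exp_add, abs_mul]
    gcongr
    nlinarith [mul_nonneg ha (sq_nonneg (|x| - |y|))]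
  have e : ∀ z : ℝ, Real.exp z = Real.exp (z / 2) ^ 2 := by
    intro z; rw [← Real.exp_nat_mul]; congr 1; push_cast; ring
  rw [e (|x| ^ 2 * a), e (|y| ^ 2 * a)]
  nlinarith [sq_nonneg (Real.exp (|x| ^ 2 * a / 2) - Real.exp (|y| ^ 2 * a / 2))]

/-- By the arithmetic-geometric mean inequality, used in the exponent and then for the exponentials,
a product of two sub-Gaussian forms is sub-exponential with the same bound 2. This is the moment
condition of Bernstein's inequality with `a = 1/K²`. -/
theorem SubGaussianVector.exp_product (h : SubGaussianVector P K) {u w : Fin p → ℝ}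
    (hu : ∑ j, u j ^ 2 = 1) (hw : ∑ j, w j ^ 2 = 1) :
    Integrable (fun x => Real.exp ((K ^ 2)⁻¹ * |(∑ j, u j * x j) * (∑ j, w j * x j)|)) P ∧
      ∫ x, Real.exp ((K ^ 2)⁻¹ * |(∑ j, u j * x j) * (∑ j, w j * x j)|) ∂P ≤ 2 := by
  obtain ⟨i1, b1⟩ := h u hu
  obtain ⟨i2, b2⟩ := h w hw
  simp only [div_eq_mul_inv] at i1 i2 b1 b2
  have hpt := fun x : Fin p → ℝ => exp_abs_mul_le (K ^ 2)⁻¹ (∑ j, u j * x j) (∑ j, w j * x j)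
    (by positivity)
  have hi : Integrable (fun x : Fin p → ℝ => (Real.exp (|∑ j, u j * x j| ^ 2 * (K ^ 2)⁻¹) +
      Real.exp (|∑ j, w j * x j| ^ 2 * (K ^ 2)⁻¹)) / 2) P := (i1.add i2).div_const 2
  have hint : Integrable
      (fun x => Real.exp ((K ^ 2)⁻¹ * |(∑ j, u j * x j) * (∑ j, w j * x j)|)) P := by
    refine Integrable.mono' hi (Measurable.aestronglyMeasurable (by fun_prop))
      (ae_of_all _ fun x => ?_)
    rw [Real.norm_eq_abs, abs_of_pos (Real.exp_pos _)]
    exact hpt x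
  refine ⟨hint, (integral_mono hint hi hpt).trans ?_⟩
  rw [integral_div, integral_add i1 i2]
  linarith

theorem sum_single_sq (i : Fin p) : ∑ j, (Pi.single i (1 : ℝ) : Fin p → ℝ) j ^ 2 = 1 := by
  simp [Pi.single_apply, ite_pow]

theorem sum_single_mul (i : Fin p) (x : Fin p → ℝ) :
    ∑ j, (Pi.single i (1 : ℝ) : Fin p → ℝ) j * x j = x i := by
  simp [Pi.single_apply]

theorem SubGaussianVector.integrable_mul (h : SubGaussianVector P K) (hK : 0 < K)
    (i j : Fin p) : Integrable (fun x : Fin p → ℝ => x i * x j) P := by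
  have h1 := (h.exp_product (sum_single_sq i) (sum_single_sq j)).1
  simp only [sum_single_mul] at h1
  exact integrable_of_integrable_exp_abs (by fun_prop) (by positivity) h1

theorem covMatrix_apply (hm : ∀ j, ∫ x, x j ∂P = 0) (i j : Fin p) :
    covMatrix P i j = ∫ x, x i * x j ∂P := by
  simp [covMatrix, covariance, hm]

/-- Concentration of `u ⬝ Σ̂ w` around `u ⬝ Σ₀ w` for unit vectors. -/
theorem SubGaussianVector.measureReal_bilin_le [IsProbabilityMeasure P] (h : SubGaussianVector P K) (hK : 0 < K)
    (hm : ∀ j, ∫ x, x j ∂P = 0)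
    {Ω : Type*} [MeasurableSpace Ω] {μ : Measure Ω} {n : ℕ} {X : Fin n → Ω → Fin p → ℝ}
    (hX : ∀ i, HasLaw (X i) P μ) (hindep : iIndepFun X μ) (hn : 0 < n)
    {u w : Fin p → ℝ} (hu : ∑ j, u j ^ 2 = 1) (hw : ∑ j, w j ^ 2 = 1)
    {t : ℝ} (ht0 : 0 ≤ t) (ht : t ≤ 16 * K ^ 2) :
    μ.real {ω | t ≤ |u ⬝ᵥ (sampleCov (Matrix.of fun i => X i ω)).mulVec w -
      u ⬝ᵥ (covMatrix P).mulVec w|} ≤ 2 * Real.exp (-(n * (t ^ 2 / (64 * K ^ 4)))) := by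
  obtain ⟨hi, h2⟩ := h.exp_product hu hw
  have hmain := measureReal_le_abs_sum_le (f := fun x : Fin p → ℝ =>
    (∑ j, u j * x j) * (∑ j, w j * x j)) (by fun_prop) (by positivity) hi h2 hX hindep ht0
    (by simpa [div_eq_mul_inv] using ht)
  have hmean : ∫ x, (∑ j, u j * x j) * (∑ j, w j * x j) ∂P = u ⬝ᵥ (covMatrix P).mulVec w := by
    have e : ∀ x : Fin p → ℝ, (∑ j, u j * x j) * (∑ j, w j * x j) =
        ∑ i, ∑ j, u i * w j * (x i * x j) := by
      intro x
      rw [Finset.sum_mul_sum]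
      exact Finset.sum_congr rfl fun i _ => Finset.sum_congr rfl fun j _ => by ring
    simp_rw [e]
    rw [integral_finsetSum _ fun i _ => integrable_finsetSum _ fun j _ =>
      (h.integrable_mul hK i j).const_mul _]
    simp only [dotProduct, Matrix.mulVec, Finset.mul_sum]
    refine Finset.sum_congr rfl fun i _ => ?_
    rw [integral_finsetSum _ fun j _ => (h.integrable_mul hK i j).const_mul _]
    refine Finset.sum_congr rfl fun j _ => ?_
    rw [integral_const_mul, covMatrix_apply hm]
    ring
  have hsamp : ∀ ω, ∑ i, (∑ j, u j * X i ω j) * (∑ j, w j * X i ω j) =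
      n * (u ⬝ᵥ (sampleCov (Matrix.of fun i => X i ω)).mulVec w) := by
    intro ω
    have hn' : (n : ℝ) ≠ 0 := by positivity
    rw [sampleCov, Matrix.smul_mulVec, dotProduct_smul, smul_eq_mul, mul_inv_cancel_left₀ hn',
      ← Matrix.mulVec_mulVec, Matrix.dotProduct_mulVec, Matrix.vecMul_transpose]
    simp only [dotProduct, Matrix.mulVec, Matrix.of_apply]
    refine Finset.sum_congr rfl fun i _ => ?_
    congr 1 <;> exact Finset.sum_congr rfl fun j _ => by ring
  simp_rw [hmean, hsamp] at hmain
  have hset : {ω | t ≤ |u ⬝ᵥ (sampleCov (Matrix.of fun i => X i ω)).mulVec w -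
      u ⬝ᵥ (covMatrix P).mulVec w|} = {ω | n * t ≤
      |n * (u ⬝ᵥ (sampleCov (Matrix.of fun i => X i ω)).mulVec w) -
        n * (u ⬝ᵥ (covMatrix P).mulVec w)|} := by
    ext ω
    have hn' : (0 : ℝ) < n := by positivity
    simp only [Set.mem_ofPred_eq]
    rw [← mul_sub, abs_mul, abs_of_pos hn', mul_le_mul_iff_right₀ hn']
  rw [hset]
  convert hmain using 4
  field_simp

end SubGaussian

open Matrix

/-! ### Quadratic form bounds from the spectrum. -/

section Spectral

variable {p : ℕ} {M : Matrix (Fin p) (Fin p) ℝ} {L : ℝ}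

theorem le_dotProduct_mulVec_of_spectrum {a : ℝ} (hM : M.IsHermitian)
    (h : ∀ r ∈ spectrum ℝ M, a ≤ r) (x : Fin p → ℝ) : a * (x ⬝ᵥ x) ≤ x ⬝ᵥ M *ᵥ x := by
  have hpsd : (M - algebraMap ℝ _ a).PosSemidef := by
    rw [posSemidef_iff_isHermitian_and_spectrum_nonneg]
    refine ⟨hM.sub ?_, ?_⟩
    · rw [Matrix.algebraMap_eq_diagonal]
      exact isHermitian_diagonal _
    · rw [← spectrum.sub_singleton_eq]
      rintro _ ⟨r, hr, _, rfl, rfl⟩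
      simpa using h r hr
  have := hpsd.dotProduct_mulVec_nonneg x
  rw [sub_mulVec, dotProduct_sub, Algebra.algebraMap_eq_smul_one, smul_mulVec, one_mulVec,
    dotProduct_smul] at this
  simpa using this

theorem dotProduct_mulVec_le_of_spectrum {b : ℝ} (hM : M.IsHermitian)
    (h : ∀ r ∈ spectrum ℝ M, r ≤ b) (x : Fin p → ℝ) : x ⬝ᵥ M *ᵥ x ≤ b * (x ⬝ᵥ x) := by
  have := le_dotProduct_mulVec_of_spectrum (M := -M) (a := -b) hM.neg (by
    intro r hr
    rw [← spectrum.neg_eq] at hr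
    have := h _ (Set.mem_neg.1 hr)
    linarith) x
  rw [neg_mulVec, dotProduct_neg] at this
  linarith

/-- The bounds on a symmetric matrix that follow from its spectrum lying in `[1/L, L]`. -/
structure WellConditioned (M : Matrix (Fin p) (Fin p) ℝ) (L : ℝ) : Prop where
  isSymm : M.IsSymm
  lower : ∀ x, (x ⬝ᵥ x) / L ≤ x ⬝ᵥ M *ᵥ x
  upper : ∀ x, x ⬝ᵥ M *ᵥ x ≤ L * (x ⬝ᵥ x)

theorem wellConditioned_of_spectrum (hM : M.IsSymm) (h : spectrum ℝ M ⊆ Set.Icc (1 / L) L) :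
    WellConditioned M L := by
  have hH : M.IsHermitian := by rw [IsHermitian, conjTranspose_eq_transpose_of_trivial, hM.eq]
  refine ⟨hM, fun x => ?_, dotProduct_mulVec_le_of_spectrum hH fun r hr => (h hr).2⟩
  have := le_dotProduct_mulVec_of_spectrum hH (fun r hr => (h hr).1) x
  rwa [div_mul_eq_mul_div, one_mul] at this

theorem IsSymm.dotProduct_mulVec_comm (hM : M.IsSymm) (x y : Fin p → ℝ) :
    x ⬝ᵥ M *ᵥ y = y ⬝ᵥ M *ᵥ x := by
  rw [dotProduct_mulVec, ← mulVec_transpose, hM.eq, dotProduct_comm]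

/-- The form is nonnegative at `M x - L x`; expanding it there and using `upper` at `M x` gives the
bound without diagonalizing `M`. At basis vectors it controls the ℓ₂ norms of the columns. -/
theorem WellConditioned.norm_mulVec_sq_le (h : WellConditioned M L) (hL : 0 < L)
    (x : Fin p → ℝ) : (M *ᵥ x) ⬝ᵥ (M *ᵥ x) ≤ L * (x ⬝ᵥ M *ᵥ x) := by
  set y := M *ᵥ x
  have h1 := h.upper y
  have h2 := h.lower (y - L • x)
  have h3 : 0 ≤ ((y - L • x) ⬝ᵥ (y - L • x)) / L :=
    div_nonneg (by simpa using dotProduct_self_star_nonneg (y - L • x)) hL.le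
  have h4 := h3.trans h2
  have e1 : x ⬝ᵥ M *ᵥ y = y ⬝ᵥ y := IsSymm.dotProduct_mulVec_comm h.isSymm x y
  rw [mulVec_sub, mulVec_smul, sub_dotProduct, dotProduct_sub, dotProduct_sub, smul_dotProduct,
    smul_dotProduct, dotProduct_smul, dotProduct_smul, e1] at h4
  simp only [smul_eq_mul] at h4
  change 0 ≤ y ⬝ᵥ M *ᵥ y - L * (y ⬝ᵥ y) - (L * (y ⬝ᵥ y) - L * (L * (x ⬝ᵥ y))) at h4
  have : L * (y ⬝ᵥ y) ≤ L * (L * (x ⬝ᵥ y)) := by linarith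
  exact le_of_mul_le_mul_left this hL

theorem WellConditioned.one_div_le_diag (h : WellConditioned M L) (j : Fin p) : 1 / L ≤ M j j := by
  simpa using h.lower (Pi.single j 1)

theorem WellConditioned.diag_le (h : WellConditioned M L) (j : Fin p) : M j j ≤ L := by
  simpa using h.upper (Pi.single j 1)

theorem WellConditioned.sum_col_sq_le (h : WellConditioned M L) (hL : 0 < L) (j : Fin p) :
    ∑ i, M i j ^ 2 ≤ L ^ 2 := by
  have h1 := h.norm_mulVec_sq_le hL (Pi.single j 1)
  have h2 := h.diag_le j
  have h3 : ∑ i, M i j ^ 2 ≤ L * M j j := by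
    simpa [dotProduct, ← sq, Pi.single_apply] using h1
  nlinarith

theorem covMatrix_isSymm (P : MeasureTheory.Measure (Fin p → ℝ)) : (covMatrix P).IsSymm := by
  ext i j
  simp [covMatrix, covariance_comm]

theorem BoundedSpectrum.wellConditioned_precision {P : MeasureTheory.Measure (Fin p → ℝ)}
    (h : BoundedSpectrum P L) : WellConditioned (precision P) L :=
  wellConditioned_of_spectrum (by
    rw [precision, IsSymm, transpose_nonsing_inv, (covMatrix_isSymm P).eq]) h.2

/-- The interval `[1/L, L]` is stable under inversion. -/
theorem BoundedSpectrum.wellConditioned_covMatrix {P : MeasureTheory.Measure (Fin p → ℝ)}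
    (h : BoundedSpectrum P L) (hL : 0 < L) : WellConditioned (covMatrix P) L := by
  refine wellConditioned_of_spectrum (covMatrix_isSymm P) fun r hr => ?_
  obtain ⟨a, ha⟩ := h.1
  have hr0 : r ≠ 0 := by
    rintro rfl
    exact spectrum.zero_notMem ℝ h.1 hr
  have hmem : r⁻¹ ∈ spectrum ℝ (precision P) := by
    have e : precision P = ((a⁻¹ : (Matrix (Fin p) (Fin p) ℝ)ˣ) : Matrix (Fin p) (Fin p) ℝ) := by
      rw [precision, ← ha, coe_units_inv]
    rw [e, ← spectrum.map_inv, Set.mem_inv, inv_inv, ha]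
    exact hr
  obtain ⟨h1, h2⟩ := h.2 hmem
  have hrpos : 0 < r := inv_pos.1 (lt_of_lt_of_le (by positivity) h1)
  constructor
  · rw [div_le_iff₀ hL]
    have := mul_le_mul_of_nonneg_left h2 hrpos.le
    rwa [mul_inv_cancel₀ hr0] at this
  · have := mul_le_mul_of_nonneg_left h1 hrpos.le
    rwa [mul_inv_cancel₀ hr0, mul_one_div, div_le_one hL] at this

end Spectral

/-! ### Hölder and Cauchy–Schwarz bounds. -/

section Norms

variable {p : ℕ}

theorem abs_dotProduct_le {x y : Fin p → ℝ} {t : ℝ} (hy : ∀ k, |y k| ≤ t) :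
    |x ⬝ᵥ y| ≤ t * ∑ k, |x k| := by
  rw [Finset.mul_sum]
  refine (Finset.abs_sum_le_sum_abs _ _).trans (Finset.sum_le_sum fun k _ => ?_)
  rw [abs_mul, mul_comm]
  gcongr
  exact hy k

theorem abs_dotProduct_mulVec_le {E : Matrix (Fin p) (Fin p) ℝ} {t : ℝ}
    (hE : ∀ i j, |E i j| ≤ t) (x : Fin p → ℝ) :
    |x ⬝ᵥ E *ᵥ x| ≤ t * (∑ k, |x k|) ^ 2 := by
  have h : ∀ k, |(E *ᵥ x) k| ≤ t * ∑ k, |x k| := fun k => by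
    rw [mulVec, dotProduct_comm]
    exact abs_dotProduct_le (hE k)
  refine (abs_dotProduct_le h).trans_eq (by ring)

theorem sq_sum_abs_le_of_support {x : Fin p → ℝ} {S : Finset (Fin p)} (hS : ∀ k ∉ S, x k = 0) :
    (∑ k, |x k|) ^ 2 ≤ S.card * ∑ k, x k ^ 2 := by
  have h1 : ∑ k, |x k| = ∑ k ∈ S, |x k| :=
    (Finset.sum_subset (Finset.subset_univ S) fun k _ hk => by simp [hS k hk]).symm
  rw [h1]
  refine (sq_sum_le_card_mul_sum_sq (s := S) (f := fun k => |x k|)).trans ?_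
  gcongr
  simp only [sq_abs]
  exact Finset.sum_le_sum_of_subset_of_nonneg (Finset.subset_univ _) fun _ _ _ => sq_nonneg _

theorem abs_dotProduct_le_sqrt {x y : Fin p → ℝ} {a b : ℝ} (ha : 0 ≤ a) (hb : 0 ≤ b)
    (hx : ∑ k, x k ^ 2 ≤ a ^ 2) (hy : ∑ k, y k ^ 2 ≤ b ^ 2) : |x ⬝ᵥ y| ≤ a * b := by
  refine abs_le_of_sq_le_sq ?_ (by positivity)
  calc (x ⬝ᵥ y) ^ 2 ≤ (∑ k, x k ^ 2) * ∑ k, y k ^ 2 := Finset.sum_mul_sq_le_sq_mul_sq _ _ _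
    _ ≤ a ^ 2 * b ^ 2 := by gcongr
    _ = (a * b) ^ 2 := by ring

end Norms

/-! ### From covariance to correlation matrices. -/

section Correlation

variable {p : ℕ}

theorem corrMatrix_apply (S : Matrix (Fin p) (Fin p) ℝ) (i j : Fin p) :
    corrMatrix S i j = (√(S i i))⁻¹ * S i j * (√(S j j))⁻¹ := by
  simp [corrMatrix, invStd]

theorem corrMatrix_isSymm {S : Matrix (Fin p) (Fin p) ℝ} (hS : S.IsSymm) :
    (corrMatrix S).IsSymm := by
  ext i j
  rw [transpose_apply, corrMatrix_apply, corrMatrix_apply, hS.apply i j]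
  ring

theorem corrMatrix_diag {S : Matrix (Fin p) (Fin p) ℝ} {j : Fin p} (h : 0 < S j j) :
    corrMatrix S j j = 1 := by
  rw [corrMatrix_apply]
  have h1 : √(S j j) ≠ 0 := (Real.sqrt_pos.2 h).ne'
  field_simp
  rw [Real.sq_sqrt h.le]

theorem inv_sqrt_le_of_le {L x : ℝ} (hL : 1 ≤ L) (hx : 1 / L ≤ x) : (√x)⁻¹ ≤ L := by
  have hL0 : 0 < L := by linarith
  have hx0 : 0 < x := lt_of_lt_of_le (by positivity) hx
  rw [inv_le_comm₀ (Real.sqrt_pos.2 hx0) hL0]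
  refine Real.le_sqrt_of_sq_le (le_trans ?_ hx)
  have h1 : L⁻¹ ≤ 1 := inv_le_one_of_one_le₀ hL
  have h2 : 0 ≤ L⁻¹ := by positivity
  rw [one_div]
  nlinarith

theorem sqrt_le_of_le {L x : ℝ} (hL : 1 ≤ L) (hx : x ≤ L) : √x ≤ L := by
  rw [Real.sqrt_le_left (by linarith)]
  nlinarith

variable {Sig Tht : Matrix (Fin p) (Fin p) ℝ} {L : ℝ}

theorem corrMatrix_inv_eq (hS : WellConditioned Sig L) (hL : 1 ≤ L) (hinv : Sig * Tht = 1) :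
    (corrMatrix Sig)⁻¹ =
      diagonal (fun j => √(Sig j j)) * Tht * diagonal (fun j => √(Sig j j)) := by
  have hne : ∀ j, √(Sig j j) ≠ 0 := fun j => (Real.sqrt_pos.2
    (lt_of_lt_of_le (by positivity) (hS.one_div_le_diag j))).ne'
  have h1 : invStd Sig * diagonal (fun j => √(Sig j j)) = 1 := by
    rw [invStd, diagonal_mul_diagonal, ← diagonal_one]
    congr 1
    ext j
    exact inv_mul_cancel₀ (hne j)
  refine inv_eq_right_inv ?_
  calc corrMatrix Sig * (diagonal (fun j => √(Sig j j)) * Tht * diagonal (fun j => √(Sig j j)))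
      = invStd Sig * (Sig * ((invStd Sig * diagonal (fun j => √(Sig j j))) * Tht)) *
          diagonal (fun j => √(Sig j j)) := by
        simp only [corrMatrix, Matrix.mul_assoc]
    _ = 1 := by rw [h1, Matrix.one_mul, hinv, Matrix.mul_one, h1]

theorem corrMatrix_mul_inv (hS : WellConditioned Sig L) (hL : 1 ≤ L) (hinv : Sig * Tht = 1) :
    corrMatrix Sig * (corrMatrix Sig)⁻¹ = 1 := by
  refine mul_nonsing_inv _ ?_
  have hdet : ∀ D : Matrix (Fin p) (Fin p) ℝ, D.det ≠ 0 → IsUnit D.det := fun _ h => h.isUnit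
  refine hdet _ ?_
  have hne : ∀ j, (√(Sig j j))⁻¹ ≠ 0 := fun j => inv_ne_zero (Real.sqrt_pos.2
    (lt_of_lt_of_le (by positivity) (hS.one_div_le_diag j))).ne'
  have h2 : Sig.det ≠ 0 := by
    intro h
    have := congrArg Matrix.det hinv
    simp [h] at this
  rw [corrMatrix, det_mul, det_mul, invStd, det_diagonal]
  have := Finset.prod_ne_zero_iff.2 fun j (_ : j ∈ Finset.univ) => hne j
  exact mul_ne_zero (mul_ne_zero this h2) this

theorem corrMatrix_inv_apply (hS : WellConditioned Sig L) (hL : 1 ≤ L) (hinv : Sig * Tht = 1)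
    (i j : Fin p) : (corrMatrix Sig)⁻¹ i j = √(Sig i i) * Tht i j * √(Sig j j) := by
  rw [corrMatrix_inv_eq hS hL hinv]
  simp

theorem corrMatrix_inv_diag_bounds (hS : WellConditioned Sig L) (hT : WellConditioned Tht L)
    (hL : 1 ≤ L) (hinv : Sig * Tht = 1) (j : Fin p) :
    1 / L ^ 2 ≤ (corrMatrix Sig)⁻¹ j j ∧ (corrMatrix Sig)⁻¹ j j ≤ L ^ 2 := by
  have h1 := hS.one_div_le_diag j
  have h2 := hT.one_div_le_diag j
  have h3 := hS.diag_le j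
  have h4 := hT.diag_le j
  have hL0 : 0 < 1 / L := by positivity
  have e : (corrMatrix Sig)⁻¹ j j = Sig j j * Tht j j := by
    rw [corrMatrix_inv_apply hS hL hinv]
    have := Real.mul_self_sqrt (x := Sig j j) (by linarith)
    linear_combination (Tht j j) * this
  rw [e]
  constructor
  · calc 1 / L ^ 2 = 1 / L * (1 / L) := by ring
      _ ≤ _ := by gcongr; linarith
  · rw [sq]
    gcongr
    linarith

theorem sum_corrMatrix_inv_sq_le (hS : WellConditioned Sig L) (hT : WellConditioned Tht L)
    (hL : 1 ≤ L) (hinv : Sig * Tht = 1) (j : Fin p) :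
    ∑ i, (corrMatrix Sig)⁻¹ i j ^ 2 ≤ (L ^ 2) ^ 2 := by
  have hL0 : 0 < L := by linarith
  have hp : ∀ i, 0 ≤ Sig i i := fun i => le_trans (by positivity) (hS.one_div_le_diag i)
  calc ∑ i, (corrMatrix Sig)⁻¹ i j ^ 2 = ∑ i, Sig i i * Sig j j * Tht i j ^ 2 := by
        refine Finset.sum_congr rfl fun i _ => ?_
        rw [corrMatrix_inv_apply hS hL hinv, mul_pow, mul_pow, Real.sq_sqrt (hp i),
          Real.sq_sqrt (hp j)]
        ring
    _ ≤ ∑ i, L * L * Tht i j ^ 2 := by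
        refine Finset.sum_le_sum fun i _ => ?_
        gcongr
        · exact hp j
        · exact hS.diag_le i
        · exact hS.diag_le j
    _ = L * L * ∑ i, Tht i j ^ 2 := by rw [Finset.mul_sum]
    _ ≤ L * L * L ^ 2 := by gcongr; exact hT.sum_col_sq_le hL0 j
    _ = (L ^ 2) ^ 2 := by ring

theorem corrMatrix_lower (hS : WellConditioned Sig L) (hL : 1 ≤ L) (x : Fin p → ℝ) :
    (x ⬝ᵥ x) / L ^ 2 ≤ x ⬝ᵥ corrMatrix Sig *ᵥ x := by
  have hL0 : 0 < L := by linarith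
  set y := invStd Sig *ᵥ x with hy
  have hyk : ∀ k, y k = (√(Sig k k))⁻¹ * x k := fun k => by
    rw [hy, invStd, mulVec_diagonal]
  have e : x ⬝ᵥ corrMatrix Sig *ᵥ x = y ⬝ᵥ Sig *ᵥ y := by
    rw [corrMatrix, ← mulVec_mulVec, ← mulVec_mulVec, dotProduct_mulVec, ← hy]
    congr 1
    rw [hy, ← vecMul_transpose, invStd, diagonal_transpose]
  rw [e]
  refine le_trans ?_ (hS.lower y)
  rw [div_le_div_iff₀ (by positivity) hL0]
  have : x ⬝ᵥ x ≤ L * (y ⬝ᵥ y) := by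
    simp only [dotProduct, Finset.mul_sum]
    refine Finset.sum_le_sum fun k _ => ?_
    have hk : 0 < Sig k k := lt_of_lt_of_le (by positivity) (hS.one_div_le_diag k)
    have hs := Real.sq_sqrt hk.le
    have hx : x k = √(Sig k k) * y k := by
      rw [hyk, mul_inv_cancel_left₀ (Real.sqrt_pos.2 hk).ne']
    calc x k * x k = Sig k k * (y k * y k) := by rw [hx]; linear_combination (y k) ^ 2 * hs
      _ ≤ L * (y k * y k) := by
        gcongr
        · exact mul_self_nonneg _
        · exact hS.diag_le k
  nlinarith

section Perturbation

variable {S : Matrix (Fin p) (Fin p) ℝ} {u s : ℝ}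

theorem diag_pos_of_abs_sub_le (hS : WellConditioned Sig L) (hL : 1 ≤ L)
    (hu : u ≤ 1 / (2 * L)) (h1 : ∀ i j, |S i j - Sig i j| ≤ u) (j : Fin p) :
    1 / (2 * L) ≤ S j j := by
  have h2 := hS.one_div_le_diag j
  have h3 := (abs_le.1 (h1 j j)).1
  have : 1 / L = 1 / (2 * L) + 1 / (2 * L) := by field_simp; norm_num
  linarith

/-- The ratio `x` of the two scales satisfies `S_jj (x² - 1) = Σ_jj - S_jj`, and `|x - 1| ≤ |x² -
1|` because `x ≥ 0`. -/
theorem abs_scale_sub_one_le (hS : WellConditioned Sig L) (hL : 1 ≤ L)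
    (hu : u ≤ 1 / (2 * L)) (h1 : ∀ i j, |S i j - Sig i j| ≤ u) (j : Fin p) :
    |(√(S j j))⁻¹ * √(Sig j j) - 1| ≤ 2 * L * u := by
  have hL0 : 0 < L := by linarith
  have hSj := diag_pos_of_abs_sub_le hS hL hu h1 j
  have hpos : 0 < S j j := lt_of_lt_of_le (by positivity) hSj
  have hpos' : 0 ≤ Sig j j := le_trans (by positivity) (hS.one_div_le_diag j)
  set x := (√(S j j))⁻¹ * √(Sig j j)
  have hx : 0 ≤ x := by positivity
  have hx2 : S j j * (x ^ 2 - 1) = -(S j j - Sig j j) := by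
    rw [mul_pow, inv_pow, Real.sq_sqrt hpos.le, Real.sq_sqrt hpos']
    field_simp
    ring
  have h3 : |S j j| * |x ^ 2 - 1| ≤ u := by
    rw [← abs_mul, hx2, abs_neg]
    exact h1 j j
  rw [abs_of_pos hpos] at h3
  have h4 : |x - 1| ≤ |x ^ 2 - 1| := by
    rw [show x ^ 2 - 1 = (x - 1) * (x + 1) by ring, abs_mul]
    exact le_mul_of_one_le_right (abs_nonneg _) (by rw [abs_of_nonneg] <;> linarith)
  have h5 : 1 / (2 * L) * |x ^ 2 - 1| ≤ u := le_trans (by gcongr) h3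
  rw [div_mul_eq_mul_div, one_mul, div_le_iff₀ (by positivity)] at h5
  linarith

/-- Passing from covariance to correlation matrices preserves entrywise rates. -/
theorem abs_corrMatrix_sub_le (hS : WellConditioned Sig L) (hL : 1 ≤ L)
    (hu : u ≤ 1 / (2 * L)) (h1 : ∀ i j, |S i j - Sig i j| ≤ u) (i j : Fin p) :
    |corrMatrix S i j - corrMatrix Sig i j| ≤ 12 * L ^ 5 * u := by
  have hL0 : 0 < L := by linarith
  have hu0 : 0 ≤ u := (abs_nonneg _).trans (h1 i j)
  have hLu : 2 * L * u ≤ 1 := by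
    rw [le_div_iff₀ (by positivity)] at hu
    linarith
  have hne : ∀ k, √(Sig k k) ≠ 0 := fun k => (Real.sqrt_pos.2
    (lt_of_lt_of_le (by positivity) (hS.one_div_le_diag k))).ne'
  have hw : ∀ k, (√(S k k))⁻¹ ≤ 2 * L := fun k =>
    inv_sqrt_le_of_le (by linarith) (diag_pos_of_abs_sub_le hS hL hu h1 k)
  have hw0 : ∀ k, 0 ≤ (√(S k k))⁻¹ := fun k => by positivity
  have hv : ∀ k, (√(Sig k k))⁻¹ ≤ L := fun k => inv_sqrt_le_of_le hL (hS.one_div_le_diag k)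
  have hv0 : ∀ k, 0 ≤ (√(Sig k k))⁻¹ := fun k => by positivity
  set x : Fin p → ℝ := fun k => (√(S k k))⁻¹ * √(Sig k k) with hxdef
  have hx : ∀ k, |x k - 1| ≤ 2 * L * u := abs_scale_sub_one_le hS hL hu h1
  have hR : |corrMatrix Sig i j| ≤ L ^ 3 := by
    have : |Sig i j| ≤ L := abs_le_of_sq_le_sq ((Finset.single_le_sum
      (fun k _ => sq_nonneg (Sig k j)) (Finset.mem_univ i)).trans
        (hS.sum_col_sq_le hL0 j)) hL0.le
    rw [corrMatrix_apply, abs_mul, abs_mul, abs_of_nonneg (hv0 i), abs_of_nonneg (hv0 j)]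
    calc _ ≤ L * L * L := by gcongr <;> apply hv
      _ = L ^ 3 := by ring
  -- The error splits into the rescaled covariance error and the true correlation times `x_i x_j -
  -- 1`, the latter expanded in `x_i - 1` and `x_j - 1`.
  have e : corrMatrix S i j - corrMatrix Sig i j =
      (√(S i i))⁻¹ * (√(S j j))⁻¹ * (S i j - Sig i j) +
        corrMatrix Sig i j * ((x i - 1) * (x j - 1) + (x i - 1) + (x j - 1)) := by
    rw [corrMatrix_apply, corrMatrix_apply]
    have hi := hne i
    have hj := hne j
    simp only [hxdef]
    generalize (√(S i i))⁻¹ = a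
    generalize (√(S j j))⁻¹ = b
    field_simp
    ring
  have h2 : |(x i - 1) * (x j - 1) + (x i - 1) + (x j - 1)| ≤ 6 * L * u := by
    refine (abs_add_three _ _ _).trans ?_
    rw [abs_mul]
    have : |x i - 1| * |x j - 1| ≤ 1 * (2 * L * u) := by
      gcongr
      · exact (hx i).trans hLu
      · exact hx j
    linarith [hx i, hx j]
  rw [e]
  refine (abs_add_le _ _).trans ?_
  rw [abs_mul, abs_mul, abs_mul, abs_of_nonneg (hw0 i), abs_of_nonneg (hw0 j)]
  calc _ ≤ 2 * L * (2 * L) * u + L ^ 3 * (6 * L * u) := by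
        gcongr <;> first | exact hw _ | exact h1 i j
    _ = (4 * L ^ 2 + 6 * L ^ 4) * u := by ring
    _ ≤ 12 * L ^ 5 * u := by
        gcongr
        have a1 : L ^ 2 ≤ L ^ 5 := pow_le_pow_right₀ hL (by norm_num)
        have a2 : L ^ 4 ≤ L ^ 5 := pow_le_pow_right₀ hL (by norm_num)
        have a3 : 0 ≤ L ^ 5 := by positivity
        linarith

/-- Bounding the correlation error entrywise against the ℓ₁ norm of a column of `K₀` would cost
`√s`. Instead, the error of `S Θ` is a hypothesis and only the scale factors are perturbed. The
first-order part `B` involves `Σ` and `Θ`, whose rows and columns have ℓ₂ norm at most `L`, so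
Cauchy–Schwarz suffices. The ℓ₁ norm enters only in `D`, a product of two errors, where `s u ≤ 1`
absorbs it. -/
theorem abs_corrMatrix_mul_inv_sub_one_le (hS : WellConditioned Sig L)
    (hT : WellConditioned Tht L) (hL : 1 ≤ L) (hinv : Sig * Tht = 1)
    (hu : u ≤ 1 / (2 * L)) (h1 : ∀ i j, |S i j - Sig i j| ≤ u)
    (h2 : ∀ i j, |(S * Tht) i j - (1 : Matrix (Fin p) (Fin p) ℝ) i j| ≤ u)
    (hs1 : 1 ≤ s) (hsu : s * u ≤ 1) (hs : ∀ j, (∑ k, |Tht k j|) ^ 2 ≤ s * L ^ 2) (i j : Fin p) :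
    |(corrMatrix S * (corrMatrix Sig)⁻¹) i j - (1 : Matrix (Fin p) (Fin p) ℝ) i j| ≤
      12 * L ^ 5 * u := by
  have hL0 : 0 < L := by linarith
  have hu0 : 0 ≤ u := (abs_nonneg _).trans (h1 i j)
  set w : Fin p → ℝ := fun k => √(Sig k k) with hwdef
  set v : Fin p → ℝ := fun k => (√(S k k))⁻¹ with hvdef
  have hw0 : ∀ k, 0 ≤ w k := fun k => Real.sqrt_nonneg _
  have hv0 : ∀ k, 0 ≤ v k := fun k => by positivity
  have hw : ∀ k, w k ≤ L := fun k => sqrt_le_of_le hL (hS.diag_le k)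
  have hv : ∀ k, v k ≤ 2 * L := fun k =>
    inv_sqrt_le_of_le (by linarith) (diag_pos_of_abs_sub_le hS hL hu h1 k)
  have hx : ∀ k, |v k * w k - 1| ≤ 2 * L * u := abs_scale_sub_one_le hS hL hu h1
  set B := ∑ k, Sig i k * (v k * w k - 1) * Tht k j with hB
  set D := ∑ k, (S i k - Sig i k) * (v k * w k - 1) * Tht k j with hD
  have e : (corrMatrix S * (corrMatrix Sig)⁻¹) i j - (1 : Matrix (Fin p) (Fin p) ℝ) i j =
      v i * w j * ((S * Tht) i j - (1 : Matrix (Fin p) (Fin p) ℝ) i j) +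
        (v i * w j - 1) * (1 : Matrix (Fin p) (Fin p) ℝ) i j + v i * w j * (B + D) := by
    have e1 : (corrMatrix S * (corrMatrix Sig)⁻¹) i j = v i * w j * ((S * Tht) i j + (B + D)) := by
      rw [mul_apply, mul_apply, hB, hD, ← Finset.sum_add_distrib, ← Finset.sum_add_distrib,
        Finset.mul_sum]
      refine Finset.sum_congr rfl fun k _ => ?_
      rw [corrMatrix_inv_apply hS hL hinv, corrMatrix_apply]
      ring
    rw [e1]
    ring
  have hdiag : |(v i * w j - 1) * (1 : Matrix (Fin p) (Fin p) ℝ) i j| ≤ 2 * L * u := by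
    rcases eq_or_ne i j with rfl | hij
    · simpa using hx i
    · rw [one_apply_ne hij]
      simp only [mul_zero, abs_zero]
      positivity
  have hB' : |B| ≤ 2 * L * u * (L * L) := by
    have hcs := abs_dotProduct_le_sqrt (x := fun k => |Sig i k|) (y := fun k => |Tht k j|)
      hL0.le hL0.le (by
        simp only [sq_abs]
        simpa only [hS.isSymm.apply] using hS.sum_col_sq_le hL0 i)
      (by simpa only [sq_abs] using hT.sum_col_sq_le hL0 j)
    refine le_trans ?_ (mul_le_mul_of_nonneg_left ((le_abs_self _).trans hcs) (by positivity))
    rw [dotProduct, Finset.mul_sum]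
    refine (Finset.abs_sum_le_sum_abs _ _).trans (Finset.sum_le_sum fun k _ => ?_)
    rw [abs_mul, abs_mul, mul_comm |Sig i k|, mul_assoc]
    gcongr
    exact hx k
  have hl1 : ∑ k, |Tht k j| ≤ s * L := by
    refine abs_le_of_sq_le_sq' ((hs j).trans ?_) (by positivity) |>.2
    rw [mul_pow]
    gcongr
    nlinarith
  have hD' : |D| ≤ 2 * L * u * L := by
    calc |D| ≤ ∑ k, u * (2 * L * u) * |Tht k j| := by
          refine (Finset.abs_sum_le_sum_abs _ _).trans (Finset.sum_le_sum fun k _ => ?_)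
          rw [abs_mul, abs_mul]
          gcongr
          · exact h1 i k
          · exact hx k
      _ = u * (2 * L * u) * ∑ k, |Tht k j| := by rw [Finset.mul_sum]
      _ ≤ u * (2 * L * u) * (s * L) := by gcongr
      _ = (s * u) * (2 * L * u * L) := by ring
      _ ≤ 1 * (2 * L * u * L) := by gcongr
      _ = _ := one_mul _
  have hvw : |v i * w j| ≤ 2 * L * L := by
    rw [abs_of_nonneg (mul_nonneg (hv0 i) (hw0 j))]
    exact mul_le_mul (hv i) (hw j) (hw0 j) (by positivity)
  rw [e]
  refine (abs_add_three _ _ _).trans ?_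
  rw [abs_mul, abs_mul (v i * w j) (B + D)]
  calc _ ≤ 2 * L * L * u + 2 * L * u + 2 * L * L * (2 * L * u * (L * L) + 2 * L * u * L) := by
        gcongr
        · exact h2 i j
        · exact (abs_add_le _ _).trans (add_le_add hB' hD')
    _ = (2 * L ^ 2 + 2 * L ^ 1 + 4 * L ^ 5 + 4 * L ^ 4) * u := by ring
    _ ≤ 12 * L ^ 5 * u := by
        gcongr
        have a0 : L ^ 1 ≤ L ^ 5 := pow_le_pow_right₀ hL (by norm_num)
        have a1 : L ^ 2 ≤ L ^ 5 := pow_le_pow_right₀ hL (by norm_num)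
        have a2 : L ^ 4 ≤ L ^ 5 := pow_le_pow_right₀ hL (by norm_num)
        linarith

end Perturbation

end Correlation

/-! ### Scalar inequalities behind the square-root Lasso rates. -/

section RealEstimates

variable {ρ t lam H Q G τ τh s η : ℝ}

/-- Here `τh` and `τ` are the residual levels at the minimizer and at the target, `H` is the ℓ₁
error, `G` the cross term and `Q` the prediction error. If `τh < τ`, then `(τ - τh) τ ≤ τ² - τh² ≤
2|G|`, and dividing by `τ ≥ 1/(2ρ)` leaves `4ρ²tH`. So overfitting gains at most half of the penalty
weight `2λ` times `H`. -/
theorem neg_le_level_sub (hρ : 1 ≤ ρ) (hτ : 1 / (2 * ρ) ≤ τ) (hτh : 0 ≤ τh) (hH : 0 ≤ H)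
    (hQ : 0 ≤ Q) (hG : |G| ≤ ρ * t * H) (he : τh ^ 2 = τ ^ 2 + 2 * G + Q)
    (ht : 4 * ρ ^ 2 * t ≤ lam) : -(lam * H) ≤ τh - τ := by
  have hτ0 : 0 < τ := lt_of_lt_of_le (by positivity) hτ
  have h1 : 1 ≤ τ * (2 * ρ) := by rwa [div_le_iff₀ (by positivity)] at hτ
  have h2 := (abs_le.1 hG).1
  have h0 : 0 ≤ ρ * t * H := (abs_nonneg _).trans hG
  have hlam : 4 * ρ * (ρ * t * H) ≤ lam * H := by nlinarith
  rcases le_total τ τh with h | h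
  · have : 0 ≤ 4 * ρ * (ρ * t * H) := by positivity
    linarith
  · have h3 : (τ - τh) * τ ≤ 2 * (ρ * t * H) := by nlinarith
    have h4 : τ - τh ≤ (τ - τh) * (τ * (2 * ρ)) := le_mul_of_one_le_right (by linarith) h1
    nlinarith

/-- Rates in `ℓ₁` and in prediction from the basic inequality and the restricted eigenvalue
bound. -/
theorem rates_of_basic_inequality (hρ : 1 ≤ ρ) (hs : 1 ≤ s) (ht : 0 ≤ t) (hlam : 0 ≤ lam)
    (hη : lam + t ≤ η) (hsη : s * η ≤ 1 / (10000 * ρ ^ 4))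
    (hτ : τ ≤ 2 * ρ) (hτh : 0 ≤ τh) (hH : 0 ≤ H)
    (hG : |G| ≤ ρ * t * H) (he : τh ^ 2 = τ ^ 2 + 2 * G + Q)
    (hbasic : τh - τ ≤ 2 * lam * H) (hre : H ^ 2 / (16 * s * ρ) - t * H ^ 2 ≤ Q) :
    H ≤ 256 * ρ ^ 2 * (s * η) ∧ Q ≤ 3072 * ρ ^ 3 * (s * η ^ 2) := by
  have hη0 : 0 ≤ η := by linarith
  have hκ : s * η * (10000 * ρ ^ 4) ≤ 1 := by rwa [le_div_iff₀ (by positivity)] at hsη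
  have hρ4 : ρ ≤ ρ ^ 4 := le_self_pow₀ hρ (by norm_num)
  have hsηρ : s * η * ρ * 10000 ≤ 1 := by
    have : s * η * ρ ≤ s * η * ρ ^ 4 := by gcongr
    linarith
  have hη1 : η ≤ 1 / 10000 := by
    have h1 : η ≤ s * η := le_mul_of_one_le_left hη0 hs
    have h2 : s * η ≤ s * η * ρ := le_mul_of_one_le_right (by positivity) hρ
    linarith
  have hdiff : τh ^ 2 - τ ^ 2 ≤ 2 * lam * H * (2 * τ + 2 * lam * H) := by
    have hx : 0 ≤ 2 * lam * H := by positivity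
    nlinarith
  have hG' := (abs_le.1 hG).1
  -- `Q = τh² - τ² - 2G`, where `τh² - τ²` is at most `2λH (2τ + 2λH)`.
  have hQ : Q ≤ 8 * ρ * η * H + 4 * η ^ 2 * H ^ 2 := by
    have e1 : 2 * lam * H * (2 * τ) ≤ 2 * lam * H * (2 * (2 * ρ)) := by gcongr
    have e2 : (2 * lam * H) ^ 2 ≤ (2 * η * H) ^ 2 := by gcongr; linarith
    have e3 : ρ * H * (lam + t) ≤ ρ * H * η := by gcongr
    have e4 : 0 ≤ ρ * H * t := by positivity
    nlinarith
  -- Smallness of `s η` absorbs all terms quadratic in `H` into half of the restricted eigenvalue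
  -- term; what remains is linear in `H`.
  have hsmall : 4 * η ^ 2 * H ^ 2 + t * H ^ 2 ≤ H ^ 2 / (32 * s * ρ) := by
    rw [le_div_iff₀ (by positivity)]
    have e1 : 4 * η ^ 2 + t ≤ 2 * η := by nlinarith
    calc (4 * η ^ 2 * H ^ 2 + t * H ^ 2) * (32 * s * ρ)
        = (4 * η ^ 2 + t) * H ^ 2 * (32 * s * ρ) := by ring
      _ ≤ 2 * η * H ^ 2 * (32 * s * ρ) := by gcongr
      _ = (64 * (s * η * ρ)) * H ^ 2 := by ring
      _ ≤ 1 * H ^ 2 := by gcongr; linarith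
      _ = H ^ 2 := one_mul _
  have hhalf : H ^ 2 / (16 * s * ρ) = H ^ 2 / (32 * s * ρ) + H ^ 2 / (32 * s * ρ) := by
    field_simp; ring
  have hmain : H ^ 2 / (32 * s * ρ) ≤ 8 * ρ * η * H := by linarith
  rw [div_le_iff₀ (by positivity)] at hmain
  have hHb : H ≤ 256 * ρ ^ 2 * (s * η) := by
    rcases hH.eq_or_lt with h | h
    · rw [← h]; positivity
    · refine le_of_mul_le_mul_left ?_ h
      linarith
  refine ⟨hHb, ?_⟩
  have h4 : 4 * η ^ 2 * H ^ 2 ≤ 4 * ρ * η * H := by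
    have e1 : η * H ≤ ρ := by
      calc η * H ≤ 1 / 10000 * (256 * ρ ^ 2 * (s * η)) := by gcongr
        _ ≤ ρ * (s * η * ρ * 10000) := by
          have : 0 ≤ ρ ^ 2 * (s * η) := by positivity
          linarith
        _ ≤ ρ * 1 := by gcongr
        _ = ρ := mul_one _
    calc 4 * η ^ 2 * H ^ 2 = 4 * (η * H) * (η * H) := by ring
      _ ≤ 4 * ρ * (η * H) := by gcongr
      _ = _ := by ring
  calc Q ≤ 12 * ρ * η * H := by linarith
    _ ≤ 12 * ρ * η * (256 * ρ ^ 2 * (s * η)) := by gcongr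
    _ = _ := by ring

/-- The error of the noise level estimator `τ̃²`. -/
theorem abs_tauTilde_sub_le {m q b : ℝ} (hρ : 1 ≤ ρ) (hs : 1 ≤ s) (ht : 0 ≤ t) (hlam : 0 ≤ lam)
    (hη : lam + t ≤ η) (hsη : s * η ≤ 1 / (10000 * ρ ^ 4))
    (hτh : 0 ≤ τh) (hH : 0 ≤ H) (hb : b ≤ ρ) (hm : 1 ≤ m) (hm2 : m ^ 2 ≤ s * ρ ^ 4)
    (hq : |q - b| ≤ ρ * m * t) (hG : |G| ≤ ρ * t * H) (hQ0 : 0 ≤ Q)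
    (he : τh ^ 2 = q + 2 * G + Q) (hHb : H ≤ 256 * ρ ^ 2 * (s * η))
    (hQb : Q ≤ 3072 * ρ ^ 3 * (s * η ^ 2)) {ℓ : ℝ} (hℓ0 : 0 ≤ ℓ) (hℓ : ℓ ≤ m + H) :
    |τh ^ 2 + lam * τh * ℓ - b| ≤ 3 * ρ * (m * η) + 4096 * ρ ^ 3 * (s * η ^ 2) ∧
      3 * ρ * (m * η) + 4096 * ρ ^ 3 * (s * η ^ 2) ≤ 1 / (2 * ρ) := by
  have hη0 : 0 ≤ η := by linarith
  have hκ : s * η * (10000 * ρ ^ 4) ≤ 1 := by rwa [le_div_iff₀ (by positivity)] at hsη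
  have htη : t ≤ η := by linarith
  have hlη : lam ≤ η := by linarith
  have hη1 : η ≤ 1 := by
    have h1 : η ≤ s * η := le_mul_of_one_le_left hη0 hs
    have h2 : s * η ≤ s * η * ρ ^ 4 := le_mul_of_one_le_right (by positivity) (one_le_pow₀ hρ)
    linarith
  have hms : m ≤ s * ρ ^ 2 := by
    refine (abs_le_of_sq_le_sq' (hm2.trans ?_) (by positivity)).2
    calc s * ρ ^ 4 ≤ s * ρ ^ 4 * s := le_mul_of_one_le_right (by positivity) hs
      _ = _ := by ring
  -- This keeps the error of `τ̃²` below half of the lower bound `1/ρ` for `1/K_jj`, as the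
  -- inversion in `abs_inv_sub_inv_le` requires.
  have hδ : 3 * ρ * (m * η) + 4096 * ρ ^ 3 * (s * η ^ 2) ≤ 1 / (2 * ρ) := by
    rw [le_div_iff₀ (by positivity)]
    have e1 : m * η ≤ s * ρ ^ 2 * η := by gcongr
    have e2 : s * η ^ 2 ≤ s * η := by
      rw [sq]; nlinarith [mul_nonneg (by linarith : (0 : ℝ) ≤ s) hη0]
    calc (3 * ρ * (m * η) + 4096 * ρ ^ 3 * (s * η ^ 2)) * (2 * ρ)
        ≤ (3 * ρ * (s * ρ ^ 2 * η) + 4096 * ρ ^ 3 * (s * η)) * (2 * ρ) := by gcongr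
      _ = 8198 * (s * η * ρ ^ 4) := by ring
      _ ≤ 1 := by
        have : 0 ≤ s * η * ρ ^ 4 := by positivity
        linarith
  have hGη : |G| ≤ 256 * ρ ^ 3 * (s * η ^ 2) := by
    calc |G| ≤ ρ * t * H := hG
      _ ≤ ρ * η * (256 * ρ ^ 2 * (s * η)) := by gcongr
      _ = _ := by ring
  have hqη : |q - b| ≤ ρ * (m * η) := by
    calc |q - b| ≤ ρ * m * t := hq
      _ ≤ ρ * m * η := by gcongr
      _ = _ := by ring
  have hvar : |τh ^ 2 - b| ≤ ρ * (m * η) + 3584 * ρ ^ 3 * (s * η ^ 2) := by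
    rw [he, show q + 2 * G + Q - b = (q - b) + 2 * G + Q by ring]
    refine (abs_add_three _ _ _).trans ?_
    rw [abs_mul, abs_of_nonneg hQ0, abs_two]
    linarith
  have h0 : 0 ≤ ρ ^ 3 * (s * η ^ 2) := by positivity
  have hmη : 0 ≤ ρ * (m * η) := by positivity
  have hτρ : τh ≤ 2 * ρ := by
    refine (abs_le_of_sq_le_sq' ?_ (by positivity)).2
    have e1 := (abs_le.1 hvar).2
    have e2 : 1 / (2 * ρ) ≤ 1 := by rw [div_le_one (by positivity)]; linarith
    nlinarith
  have hpen : lam * τh * ℓ ≤ 2 * ρ * (m * η) + 512 * ρ ^ 3 * (s * η ^ 2) := by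
    calc lam * τh * ℓ ≤ η * (2 * ρ) * (m + 256 * ρ ^ 2 * (s * η)) := by gcongr; linarith
      _ = _ := by ring
  have hpen0 : 0 ≤ lam * τh * ℓ := by positivity
  refine ⟨?_, hδ⟩
  rw [show τh ^ 2 + lam * τh * ℓ - b = (τh ^ 2 - b) + lam * τh * ℓ by ring]
  refine (abs_add_le _ _).trans ?_
  rw [abs_of_nonneg hpen0]
  linarith

theorem abs_inv_sub_inv_le {a b x δ : ℝ} (hρ : 1 ≤ ρ) (ha : 1 / ρ ≤ a) (haρ : a ≤ ρ)
    (hb : b = a⁻¹) (hx : |x - b| ≤ δ) (hδ : δ ≤ 1 / (2 * ρ)) :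
    0 < x ∧ x⁻¹ ≤ 2 * ρ ∧ |x⁻¹ - a| ≤ 2 * ρ ^ 2 * δ := by
  have hρ0 : 0 < ρ := by linarith
  have ha0 : 0 < a := lt_of_lt_of_le (by positivity) ha
  have hbρ : 1 / ρ ≤ b := by
    rw [hb, one_div]
    gcongr
  have hxl : 1 / (2 * ρ) ≤ x := by
    have h1 := (abs_le.1 hx).1
    have h2 : 1 / ρ = 1 / (2 * ρ) + 1 / (2 * ρ) := by field_simp; norm_num
    linarith
  have hx0 : 0 < x := lt_of_lt_of_le (by positivity) hxl
  have hxi : x⁻¹ ≤ 2 * ρ := by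
    rw [inv_le_comm₀ hx0 (by positivity), ← one_div]
    exact hxl
  refine ⟨hx0, hxi, ?_⟩
  have e : x⁻¹ - a = -(a * x⁻¹ * (x - b)) := by
    rw [hb]; field_simp; ring
  rw [e, abs_neg, abs_mul, abs_of_nonneg (by positivity : 0 ≤ a * x⁻¹)]
  calc a * x⁻¹ * |x - b| ≤ ρ * (2 * ρ) * δ := by gcongr
    _ = _ := by ring

end RealEstimates

/-! ### Deterministic analysis of one nodewise regression. -/

section Deterministic

variable {p : ℕ}

/-- `K` is an approximate inverse of the Gram matrix `A`, up to entrywise error `t`, with columns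
of effective sparsity `s`, and `A` satisfies the corresponding restricted eigenvalue bound. -/
structure ApproxInverse (A K : Matrix (Fin p) (Fin p) ℝ) (ρ t s : ℝ) : Prop where
  one_le_rho : 1 ≤ ρ
  one_le_s : 1 ≤ s
  t_nonneg : 0 ≤ t
  isSymm : A.IsSymm
  nonneg : ∀ x, 0 ≤ x ⬝ᵥ A *ᵥ x
  lower : ∀ x, (x ⬝ᵥ x) / ρ - t * (∑ k, |x k|) ^ 2 ≤ x ⬝ᵥ A *ᵥ x
  noise : ∀ i j, |(A * K) i j - (1 : Matrix (Fin p) (Fin p) ℝ) i j| ≤ t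
  diag_lower : ∀ j, 1 / ρ ≤ K j j
  diag_upper : ∀ j, K j j ≤ ρ
  sparse : ∀ j, (∑ k, |K k j|) ^ 2 ≤ s * ρ ^ 2

/-- The coefficient vector `K_j / K_jj` of the population regression on the `j`-th variable. -/
noncomputable def populationVector (K : Matrix (Fin p) (Fin p) ℝ) (j : Fin p) : Fin p → ℝ :=
  (K j j)⁻¹ • fun k => K k j

theorem quad_add {A : Matrix (Fin p) (Fin p) ℝ} (hA : A.IsSymm) (x y : Fin p → ℝ) :
    (x + y) ⬝ᵥ A *ᵥ (x + y) = x ⬝ᵥ A *ᵥ x + 2 * (y ⬝ᵥ A *ᵥ x) + y ⬝ᵥ A *ᵥ y := by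
  rw [mulVec_add, add_dotProduct, dotProduct_add, dotProduct_add,
    IsSymm.dotProduct_mulVec_comm hA x y]
  ring

theorem quad_smul (A : Matrix (Fin p) (Fin p) ℝ) (c : ℝ) (x : Fin p → ℝ) :
    (c • x) ⬝ᵥ A *ᵥ (c • x) = c ^ 2 * (x ⬝ᵥ A *ᵥ x) := by
  rw [mulVec_smul, smul_dotProduct, dotProduct_smul, smul_eq_mul, smul_eq_mul]
  ring

theorem two_mul_abs_bilin_le {A : Matrix (Fin p) (Fin p) ℝ} (hA : A.IsSymm)
    (hpos : ∀ x, 0 ≤ x ⬝ᵥ A *ᵥ x) (x y : Fin p → ℝ) :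
    2 * |y ⬝ᵥ A *ᵥ x| ≤ x ⬝ᵥ A *ᵥ x + y ⬝ᵥ A *ᵥ y := by
  have h1 := hpos (x + y)
  have h2 := hpos (x + (-1 : ℝ) • y)
  rw [quad_add hA] at h1
  rw [quad_add hA, quad_smul, smul_dotProduct, smul_eq_mul] at h2
  rcases abs_cases (y ⬝ᵥ A *ᵥ x) with ⟨h, _⟩ | ⟨h, _⟩ <;> rw [h] <;> linarith

theorem quad_add_le {A : Matrix (Fin p) (Fin p) ℝ} (hA : A.IsSymm)
    (hpos : ∀ x, 0 ≤ x ⬝ᵥ A *ᵥ x) (x y : Fin p → ℝ) :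
    (x + y) ⬝ᵥ A *ᵥ (x + y) ≤ 2 * (x ⬝ᵥ A *ᵥ x) + 2 * (y ⬝ᵥ A *ᵥ y) := by
  rw [quad_add hA]
  linarith [two_mul_abs_bilin_le hA hpos x y, le_abs_self (y ⬝ᵥ A *ᵥ x)]

namespace ApproxInverse

variable {A K : Matrix (Fin p) (Fin p) ℝ} {ρ t s : ℝ}

theorem diag_pos (hA : ApproxInverse A K ρ t s) (j : Fin p) : 0 < K j j :=
  lt_of_lt_of_le (one_div_pos.2 (by linarith [hA.one_le_rho])) (hA.diag_lower j)

theorem inv_diag_le (hA : ApproxInverse A K ρ t s) (j : Fin p) : (K j j)⁻¹ ≤ ρ := by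
  rw [inv_le_comm₀ (hA.diag_pos j) (by linarith [hA.one_le_rho]), ← one_div]
  exact hA.diag_lower j

theorem populationVector_self (hA : ApproxInverse A K ρ t s) (j : Fin p) :
    populationVector K j j = 1 := by
  simp [populationVector, (hA.diag_pos j).ne']

/-- `A K_j` is the basis vector `e_j` plus noise. Against vectors vanishing at `j` only noise
survives, the sample form of orthogonality of the regression residual; against the target itself the
value is `1/K_jj` plus noise. -/
theorem dotProduct_mulVec_population (A K : Matrix (Fin p) (Fin p) ℝ) (j : Fin p)
    (x : Fin p → ℝ) :
    x ⬝ᵥ A *ᵥ populationVector K j = (K j j)⁻¹ * (x j +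
      x ⬝ᵥ fun k => (A * K) k j - (1 : Matrix (Fin p) (Fin p) ℝ) k j) := by
  rw [populationVector, mulVec_smul, dotProduct_smul, smul_eq_mul]
  congr 1
  have e : (A *ᵥ fun k => K k j) = fun k => (A * K) k j := by
    ext k; simp [mulVec, mul_apply, dotProduct]
  rw [e]
  simp [dotProduct, mul_sub, Finset.sum_sub_distrib, one_apply]

theorem abs_bilin_population_le (hA : ApproxInverse A K ρ t s) (j : Fin p) {h : Fin p → ℝ}
    (hj : h j = 0) :
    |h ⬝ᵥ A *ᵥ populationVector K j| ≤ ρ * t * ∑ k, |h k| := by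
  have h1 := abs_dotProduct_le (x := h) (fun k => hA.noise k j)
  have h2 := (hA.diag_pos j)
  have h3 := hA.inv_diag_le j
  have h4 := hA.t_nonneg
  have hρ0 : 0 ≤ ρ := by linarith [hA.one_le_rho]
  rw [dotProduct_mulVec_population, hj, zero_add, abs_mul, abs_of_pos (inv_pos.2 h2), mul_assoc]
  gcongr

theorem abs_quad_population_sub_le (hA : ApproxInverse A K ρ t s) (j : Fin p) :
    |populationVector K j ⬝ᵥ A *ᵥ populationVector K j - (K j j)⁻¹| ≤
      ρ * (∑ k, |populationVector K j k|) * t := by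
  have h1 := abs_dotProduct_le (x := populationVector K j) (fun k => hA.noise k j)
  have h2 := (hA.diag_pos j)
  have h3 := hA.inv_diag_le j
  have h4 := hA.t_nonneg
  have hρ0 : 0 ≤ ρ := by linarith [hA.one_le_rho]
  rw [dotProduct_mulVec_population, hA.populationVector_self, mul_add, mul_one,
    add_sub_cancel_left, abs_mul, abs_of_pos (inv_pos.2 h2), mul_assoc, mul_comm _ t]
  gcongr

theorem one_le_l1_population (hA : ApproxInverse A K ρ t s) (j : Fin p) :
    1 ≤ ∑ k, |populationVector K j k| := by
  have := Finset.single_le_sum (fun k _ => abs_nonneg (populationVector K j k))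
    (Finset.mem_univ j)
  simpa [hA.populationVector_self] using this

theorem l1_population_sq_le (hA : ApproxInverse A K ρ t s) (j : Fin p) :
    (∑ k, |populationVector K j k|) ^ 2 ≤ s * ρ ^ 4 := by
  have h2 := (hA.diag_pos j)
  have h3 := hA.inv_diag_le j
  have e : ∑ k, |populationVector K j k| = (K j j)⁻¹ * ∑ k, |K k j| := by
    rw [Finset.mul_sum]
    refine Finset.sum_congr rfl fun k _ => ?_
    rw [populationVector, Pi.smul_apply, smul_eq_mul, abs_mul, abs_of_pos (inv_pos.2 h2)]
  rw [e, mul_pow]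
  calc (K j j)⁻¹ ^ 2 * (∑ k, |K k j|) ^ 2 ≤ ρ ^ 2 * (s * ρ ^ 2) := by
        gcongr
        exact hA.sparse j
    _ = _ := by ring

theorem quad_population_bounds (hA : ApproxInverse A K ρ t s) (j : Fin p) {η : ℝ} (htη : t ≤ η)
    (hsη : s * η ≤ 1 / (10000 * ρ ^ 4)) :
    1 / (2 * ρ) ≤ populationVector K j ⬝ᵥ A *ᵥ populationVector K j ∧
      populationVector K j ⬝ᵥ A *ᵥ populationVector K j ≤ 2 * ρ := by
  have hρ := hA.one_le_rho
  have hs := hA.one_le_s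
  have ht := hA.t_nonneg
  have hm2 := hA.l1_population_sq_le j
  have hq := hA.abs_quad_population_sub_le j
  set m := ∑ k, |populationVector K j k|
  have hm0 : 0 ≤ m := Finset.sum_nonneg fun _ _ => abs_nonneg _
  have hκ : s * η * (10000 * ρ ^ 4) ≤ 1 := by rwa [le_div_iff₀ (by positivity)] at hsη
  have hms : m ≤ s * ρ ^ 2 := by
    refine (abs_le_of_sq_le_sq' (hm2.trans ?_) (by positivity)).2
    calc s * ρ ^ 4 ≤ s * ρ ^ 4 * s := le_mul_of_one_le_right (by positivity) hs
      _ = _ := by ring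
  have h1 : ρ * m * t ≤ 1 / (2 * ρ) := by
    rw [le_div_iff₀ (by positivity)]
    calc ρ * m * t * (2 * ρ) ≤ ρ * (s * ρ ^ 2) * η * (2 * ρ) := by gcongr
      _ = 2 * (s * η * ρ ^ 4) := by ring
      _ ≤ 1 := by
        have : 0 ≤ s * η * ρ ^ 4 := by
          have : 0 ≤ η := ht.trans htη
          positivity
        linarith
  have h2 : 1 / ρ ≤ (K j j)⁻¹ := by
    rw [one_div]
    exact inv_anti₀ (hA.diag_pos j) (hA.diag_upper j)
  have h3 := hA.inv_diag_le j
  have h4 : 1 / ρ = 1 / (2 * ρ) + 1 / (2 * ρ) := by field_simp; norm_num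
  have h5 : 1 / (2 * ρ) ≤ 1 := by rw [div_le_one (by positivity)]; linarith
  obtain ⟨h6, h7⟩ := abs_le.1 hq
  constructor <;> linarith

section Column

variable {w : Fin p → ℝ} {lam η : ℝ}

theorem quad_decomposition (hA : ApproxInverse A K ρ t s) (j : Fin p) (w : Fin p → ℝ) :
    w ⬝ᵥ A *ᵥ w = populationVector K j ⬝ᵥ A *ᵥ populationVector K j +
      2 * ((w - populationVector K j) ⬝ᵥ A *ᵥ populationVector K j) +
      (w - populationVector K j) ⬝ᵥ A *ᵥ (w - populationVector K j) := by
  rw [← quad_add hA.isSymm, add_sub_cancel]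

theorem sq_sqrt_quad (hA : ApproxInverse A K ρ t s) (x : Fin p → ℝ) :
    √(x ⬝ᵥ A *ᵥ x) ^ 2 = x ⬝ᵥ A *ᵥ x := Real.sq_sqrt (hA.nonneg x)

theorem sqrt_quad_population_bounds (hA : ApproxInverse A K ρ t s) (j : Fin p) (htη : t ≤ η)
    (hsη : s * η ≤ 1 / (10000 * ρ ^ 4)) :
    1 / (2 * ρ) ≤ √(populationVector K j ⬝ᵥ A *ᵥ populationVector K j) ∧
      √(populationVector K j ⬝ᵥ A *ᵥ populationVector K j) ≤ 2 * ρ := by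
  have hρ := hA.one_le_rho
  obtain ⟨h1, h2⟩ := hA.quad_population_bounds j htη hsη
  have h5 : 1 / (2 * ρ) ≤ 1 := by rw [div_le_one (by positivity)]; linarith
  have h6 : 0 ≤ 1 / (2 * ρ) := by positivity
  constructor
  · refine Real.le_sqrt_of_sq_le (le_trans ?_ h1)
    nlinarith
  · rw [Real.sqrt_le_left (by positivity)]
    nlinarith

/-- The cone condition for the estimation error. -/
theorem l1_error_le_support (hA : ApproxInverse A K ρ t s) (j : Fin p) (hwj : w j = 1)
    (hmin : √(w ⬝ᵥ A *ᵥ w) + 2 * lam * ∑ k, |w k| ≤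
      √(populationVector K j ⬝ᵥ A *ᵥ populationVector K j) +
        2 * lam * ∑ k, |populationVector K j k|)
    (htη : t ≤ η) (hsη : s * η ≤ 1 / (10000 * ρ ^ 4)) (hlam : 0 < lam)
    (htl : 4 * ρ ^ 2 * t ≤ lam) {S : Finset (Fin p)} (hS : ∀ k ∉ S, k ≠ j → K k j = 0) :
    ∑ k, |w k - populationVector K j k| ≤ 4 * ∑ k ∈ S, |w k - populationVector K j k| := by
  have hvj := hA.populationVector_self j
  have hlev := neg_le_level_sub hA.one_le_rho (hA.sqrt_quad_population_bounds j htη hsη).1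
    (Real.sqrt_nonneg (w ⬝ᵥ A *ᵥ w)) (Finset.sum_nonneg fun k _ => abs_nonneg _)
    (hA.nonneg (w - populationVector K j))
    (hA.abs_bilin_population_le j (h := w - populationVector K j) (by simp [hwj, hvj]))
    (by rw [hA.sq_sqrt_quad, hA.sq_sqrt_quad]; exact hA.quad_decomposition j w) htl
  simp only [Pi.sub_apply] at hlev
  set v := populationVector K j with hv
  -- The error vanishes at `j`, so `S` need not contain `j`; elsewhere off `S` the target vanishes.
  have hdiff : ∑ k, |v k| - ∑ k, |w k| ≤
      2 * ∑ k ∈ S, |w k - v k| - ∑ k, |w k - v k| := by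
    have e : ∑ k ∈ S, |w k - v k| = ∑ k, if k ∈ S then |w k - v k| else 0 := by
      simp
    rw [e, Finset.mul_sum, ← Finset.sum_sub_distrib, ← Finset.sum_sub_distrib]
    refine Finset.sum_le_sum fun k _ => ?_
    by_cases hk : k ∈ S
    · rw [if_pos hk]
      have := abs_sub_abs_le_abs_sub (v k) (w k)
      rw [abs_sub_comm] at this
      linarith
    · rw [if_neg hk]
      rcases eq_or_ne k j with rfl | hkj
      · simp [hwj, hvj]
      · have : v k = 0 := by simp [hv, populationVector, hS k hk hkj]
        simp [this]
  have h2 : 2 * lam * (∑ k, |v k| - ∑ k, |w k|) ≤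
      2 * lam * (2 * ∑ k ∈ S, |w k - v k| - ∑ k, |w k - v k|) := by gcongr
  -- With `H` and `H_S` the ℓ₁ errors in all and on `S`, minimality gives `2λ(H - 2H_S) ≤ τ - τ̂ ≤
  -- λH`, that is `H ≤ 4H_S`.
  refine le_of_mul_le_mul_left ?_ hlam
  linarith

/-- Compatibility is a hypothesis because it has two sources: the cone condition in the sparse
regime, and Cauchy–Schwarz over all coordinates when `p ≤ s`. The factor 16 is the square of the
cone constant. -/
theorem column_rates (hA : ApproxInverse A K ρ t s) (j : Fin p) (hwj : w j = 1)
    (hmin : √(w ⬝ᵥ A *ᵥ w) + 2 * lam * ∑ k, |w k| ≤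
      √(populationVector K j ⬝ᵥ A *ᵥ populationVector K j) +
        2 * lam * ∑ k, |populationVector K j k|)
    (hη : lam + t ≤ η) (hsη : s * η ≤ 1 / (10000 * ρ ^ 4)) (hlam : 0 ≤ lam)
    (hcomp : (∑ k, |w k - populationVector K j k|) ^ 2 ≤
      16 * s * ∑ k, (w k - populationVector K j k) ^ 2) :
    ∑ k, |w k - populationVector K j k| ≤ 256 * ρ ^ 2 * (s * η) ∧
      (w - populationVector K j) ⬝ᵥ A *ᵥ (w - populationVector K j) ≤
        3072 * ρ ^ 3 * (s * η ^ 2) := by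
  have hρ := hA.one_le_rho
  have hs := hA.one_le_s
  have ht := hA.t_nonneg
  have hvj := hA.populationVector_self j
  obtain ⟨hτ1, hτ2⟩ := hA.sqrt_quad_population_bounds j (η := η) (by linarith) hsη
  refine rates_of_basic_inequality hρ hs ht hlam hη hsη hτ2
    (Real.sqrt_nonneg (w ⬝ᵥ A *ᵥ w)) (Finset.sum_nonneg fun k _ => abs_nonneg _)
    (hA.abs_bilin_population_le j (h := w - populationVector K j) (by simp [hwj, hvj]))
    (by rw [hA.sq_sqrt_quad, hA.sq_sqrt_quad]; exact hA.quad_decomposition j w) ?_ ?_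
  · have h1 : ∑ k, |populationVector K j k| - ∑ k, |w k| ≤
        ∑ k, |w k - populationVector K j k| := by
      rw [← Finset.sum_sub_distrib]
      refine Finset.sum_le_sum fun k _ => ?_
      rw [abs_sub_comm]
      exact abs_sub_abs_le_abs_sub _ _
    have h2 := mul_le_mul_of_nonneg_left h1 (by positivity : 0 ≤ 2 * lam)
    linarith
  · refine le_trans ?_ (hA.lower (w - populationVector K j))
    have h1 : (w - populationVector K j) ⬝ᵥ (w - populationVector K j) =
        ∑ k, (w k - populationVector K j k) ^ 2 := by
      simp [dotProduct, sq]
    rw [h1]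
    simp only [Pi.sub_apply]
    refine sub_le_sub_right ?_ _
    rw [div_le_div_iff₀ (by positivity) (by positivity)]
    calc _ ≤ (16 * s * ∑ k, (w k - populationVector K j k) ^ 2) * ρ := by gcongr
      _ = _ := by ring

theorem column_error (hA : ApproxInverse A K ρ t s) (j : Fin p) (hwj : w j = 1)
    (hmin : √(w ⬝ᵥ A *ᵥ w) + 2 * lam * ∑ k, |w k| ≤
      √(populationVector K j ⬝ᵥ A *ᵥ populationVector K j) +
        2 * lam * ∑ k, |populationVector K j k|)
    (hη : lam + t ≤ η) (hsη : s * η ≤ 1 / (10000 * ρ ^ 4)) (hlam : 0 ≤ lam)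
    (hcomp : (∑ k, |w k - populationVector K j k|) ^ 2 ≤
      16 * s * ∑ k, (w k - populationVector K j k) ^ 2)
    {u : Fin p → ℝ} (hu : ∀ k, u k = w k / (w ⬝ᵥ A *ᵥ w +
      lam * √(w ⬝ᵥ A *ᵥ w) * (∑ k, |w k| - 1)) - K k j) :
    ∑ k, |u k| ≤ 520 * ρ ^ 7 * (s * η) ∧ u ⬝ᵥ A *ᵥ u ≤ 25000 * ρ ^ 11 * (s * η ^ 2) := by
  have hρ := hA.one_le_rho
  have hs := hA.one_le_s
  have ht := hA.t_nonneg
  have hη0 : 0 ≤ η := by linarith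
  obtain ⟨hH, hQ⟩ := hA.column_rates j hwj hmin hη hsη hlam hcomp
  have hq := hA.abs_quad_population_sub_le j
  have hm1 := hA.one_le_l1_population j
  have hm2 := hA.l1_population_sq_le j
  have hvj := hA.populationVector_self j
  have hG := hA.abs_bilin_population_le j (h := w - populationVector K j) (by simp [hwj, hvj])
  have hdec := hA.quad_decomposition j w
  have hqb := hA.quad_population_bounds j (η := η) (by linarith) hsη
  have hcol : ∀ k, K k j = K j j * populationVector K j k := fun k => by
    simp [populationVector, (hA.diag_pos j).ne']
  set v := populationVector K j with hv
  set h := w - v with hh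
  have hhk : ∀ k, h k = w k - v k := fun k => rfl
  simp only [← hhk] at hH hG
  have hw1 : 1 ≤ ∑ k, |w k| := by
    have := Finset.single_le_sum (fun k _ => abs_nonneg (w k)) (Finset.mem_univ j)
    simpa [hwj] using this
  have hwl : ∑ k, |w k| ≤ ∑ k, |v k| + ∑ k, |h k| := by
    rw [← Finset.sum_add_distrib]
    refine Finset.sum_le_sum fun k _ => ?_
    have := abs_add_le (v k) (h k)
    rwa [hhk, add_sub_cancel] at this
  have hH0 : 0 ≤ ∑ k, |h k| := Finset.sum_nonneg fun _ _ => abs_nonneg _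
  obtain ⟨hτ, hδ⟩ := abs_tauTilde_sub_le (ℓ := ∑ k, |w k| - 1) hρ hs ht hlam hη hsη
    (Real.sqrt_nonneg (w ⬝ᵥ A *ᵥ w)) hH0 (hA.inv_diag_le j) hm1 hm2 hq hG (hA.nonneg h)
    (by rw [hA.sq_sqrt_quad]; exact hdec) hH hQ (by linarith) (by linarith)
  rw [hA.sq_sqrt_quad] at hτ
  obtain ⟨hx0, hxi, hxa⟩ := abs_inv_sub_inv_le hρ (hA.diag_lower j) (hA.diag_upper j) rfl hτ hδ
  set x := w ⬝ᵥ A *ᵥ w + lam * √(w ⬝ᵥ A *ᵥ w) * (∑ k, |w k| - 1)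
  set m := ∑ k, |v k|
  set δ := 3 * ρ * (m * η) + 4096 * ρ ^ 3 * (s * η ^ 2) with hδdef
  have hδ0 : 0 ≤ δ := by positivity
  have hκ : s * η * (10000 * ρ ^ 4) ≤ 1 := by rwa [le_div_iff₀ (by positivity)] at hsη
  have hms : m ≤ s * ρ ^ 2 := by
    refine (abs_le_of_sq_le_sq' (hm2.trans ?_) (by positivity)).2
    calc s * ρ ^ 4 ≤ s * ρ ^ 4 * s := le_mul_of_one_le_right (by positivity) hs
      _ = _ := by ring
  have hρ34 : ρ ^ 3 ≤ ρ ^ 4 := pow_le_pow_right₀ hρ (by norm_num)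
  have hsmall : 4096 * ρ ^ 3 * (s * η) ≤ 1 := by
    have : ρ ^ 3 * (s * η) ≤ ρ ^ 4 * (s * η) := by gcongr
    have : 0 ≤ ρ ^ 4 * (s * η) := by positivity
    linarith
  -- The column error splits into the error of the direction and the error of the scale `1/τ̃²`.
  have huv : u = x⁻¹ • h + (x⁻¹ - K j j) • v := by
    ext k
    rw [hu, hcol]
    simp only [Pi.add_apply, Pi.smul_apply, smul_eq_mul, hhk]
    ring
  constructor
  · have h1 : ∑ k, |u k| ≤ x⁻¹ * ∑ k, |h k| + |x⁻¹ - K j j| * m := by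
      rw [Finset.mul_sum, Finset.mul_sum, ← Finset.sum_add_distrib]
      refine Finset.sum_le_sum fun k _ => ?_
      rw [huv]
      refine (abs_add_le _ _).trans ?_
      rw [Pi.smul_apply, Pi.smul_apply, smul_eq_mul, smul_eq_mul, abs_mul, abs_mul,
        abs_of_pos (inv_pos.2 hx0)]
    -- The leading part of `δ` is `m η`, and `m²` is of order `s`; the cruder bound `m ≤ s ρ²` is
    -- spent only on the part of `δ` that is quadratic in `η`.
    have hmδ : m * δ ≤ 4 * ρ ^ 5 * (s * η) := by
      have e1 : m ^ 2 * η ≤ s * ρ ^ 4 * η := by gcongr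
      have e2 : m * (4096 * ρ ^ 3 * (s * η) * η) ≤ s * ρ ^ 2 * (1 * η) := by gcongr
      have e3 : ρ ^ 2 * (s * η) ≤ ρ ^ 5 * (s * η) := by
        gcongr ?_ * _
        exact pow_le_pow_right₀ hρ (by norm_num)
      calc m * δ = 3 * ρ * (m ^ 2 * η) + m * (4096 * ρ ^ 3 * (s * η) * η) := by
            rw [hδdef]; ring
        _ ≤ 3 * ρ * (s * ρ ^ 4 * η) + s * ρ ^ 2 * (1 * η) := by gcongr
        _ = 3 * ρ ^ 5 * (s * η) + ρ ^ 2 * (s * η) := by ring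
        _ ≤ _ := by linarith
    have e3 : ρ ^ 3 * (s * η) ≤ ρ ^ 7 * (s * η) := by
      gcongr ?_ * _
      exact pow_le_pow_right₀ hρ (by norm_num)
    calc ∑ k, |u k| ≤ 2 * ρ * (256 * ρ ^ 2 * (s * η)) + 2 * ρ ^ 2 * δ * m := by
          refine h1.trans ?_
          gcongr
      _ = 512 * (ρ ^ 3 * (s * η)) + 2 * ρ ^ 2 * (m * δ) := by ring
      _ ≤ 512 * (ρ ^ 7 * (s * η)) + 2 * ρ ^ 2 * (4 * ρ ^ 5 * (s * η)) := by gcongr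
      _ = _ := by ring
  · have hδ2 : δ ^ 2 ≤ 20 * ρ ^ 6 * (s * η ^ 2) := by
      have e1 : m ^ 2 * η ^ 2 ≤ s * ρ ^ 4 * η ^ 2 := by gcongr
      have e2 : (4096 * ρ ^ 3 * (s * η) * η) ^ 2 ≤ (1 * η) ^ 2 := by gcongr
      have e3 : η ^ 2 ≤ ρ ^ 6 * (s * η ^ 2) := by
        calc η ^ 2 = 1 * (1 * η ^ 2) := by ring
          _ ≤ ρ ^ 6 * (s * η ^ 2) := by
            gcongr
            exact one_le_pow₀ hρ
      calc δ ^ 2 ≤ 2 * (3 * ρ * (m * η)) ^ 2 + 2 * (4096 * ρ ^ 3 * (s * η) * η) ^ 2 := by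
            rw [hδdef]
            nlinarith [sq_nonneg (3 * ρ * (m * η) - 4096 * ρ ^ 3 * (s * η) * η)]
        _ = 18 * ρ ^ 2 * (m ^ 2 * η ^ 2) + 2 * (4096 * ρ ^ 3 * (s * η) * η) ^ 2 := by ring
        _ ≤ 18 * ρ ^ 2 * (s * ρ ^ 4 * η ^ 2) + 2 * (1 * η) ^ 2 := by gcongr
        _ = 18 * (ρ ^ 6 * (s * η ^ 2)) + 2 * η ^ 2 := by ring
        _ ≤ _ := by linarith
    have hq0 := hA.nonneg v
    have hQ0 := hA.nonneg h
    have hx2 : x⁻¹ ^ 2 ≤ (2 * ρ) ^ 2 := by gcongr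
    have hy2 : (x⁻¹ - K j j) ^ 2 ≤ (2 * ρ ^ 2 * δ) ^ 2 := by
      rw [← sq_abs]
      gcongr
    have e3 : ρ ^ 5 * (s * η ^ 2) ≤ ρ ^ 11 * (s * η ^ 2) := by
      gcongr ?_ * _
      exact pow_le_pow_right₀ hρ (by norm_num)
    rw [huv]
    refine (quad_add_le hA.isSymm hA.nonneg _ _).trans ?_
    rw [quad_smul, quad_smul]
    calc 2 * (x⁻¹ ^ 2 * (h ⬝ᵥ A *ᵥ h)) + 2 * ((x⁻¹ - K j j) ^ 2 * (v ⬝ᵥ A *ᵥ v))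
        ≤ 2 * ((2 * ρ) ^ 2 * (3072 * ρ ^ 3 * (s * η ^ 2))) +
            2 * ((2 * ρ ^ 2 * δ) ^ 2 * (2 * ρ)) := by
          gcongr
          exact hqb.2
      _ = 24576 * (ρ ^ 5 * (s * η ^ 2)) + 16 * ρ ^ 5 * δ ^ 2 := by ring
      _ ≤ 24576 * (ρ ^ 11 * (s * η ^ 2)) + 16 * ρ ^ 5 * (20 * ρ ^ 6 * (s * η ^ 2)) := by gcongr
      _ = 24896 * (ρ ^ 11 * (s * η ^ 2)) := by ring
      _ ≤ 25000 * (ρ ^ 11 * (s * η ^ 2)) := by gcongr; norm_num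
      _ = _ := by ring

end Column

end ApproxInverse

/-! ### The remainder as a function of the estimation error. -/

/-- The remainder of the de-biased estimator is quadratic in the estimation error `T - K`. -/
theorem remainder_identity {A K R T : Matrix (Fin p) (Fin p) ℝ} (hA : A.IsSymm) (hK : K.IsSymm)
    (hRK : R * K = 1) :
    (T + Tᵀ - Tᵀ * A * T - K) - (-(K * (A - R) * K)) =
      -((T - K)ᵀ * (A * K - 1)) - (A * K - 1)ᵀ * (T - K) - (T - K)ᵀ * (A * (T - K)) := by
  have e1 : K * R * K = K := by rw [Matrix.mul_assoc, hRK, Matrix.mul_one]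
  have e2 : (A * K - 1)ᵀ = K * A - 1 := by
    rw [transpose_sub, transpose_mul, hA.eq, hK.eq, transpose_one]
  have e3 : (T - K)ᵀ = Tᵀ - K := by rw [transpose_sub, hK.eq]
  rw [e2, e3]
  generalize Tᵀ = V
  have e4 : (T + V - V * A * T - K) - (-(K * (A - R) * K)) =
      T + V - V * A * T - K + (K * A * K - K * R * K) := by noncomm_ring
  rw [e4, e1]
  noncomm_ring

theorem abs_remainder_le {A K R T : Matrix (Fin p) (Fin p) ℝ} {t b q : ℝ} (hA : A.IsSymm)
    (hpos : ∀ x, 0 ≤ x ⬝ᵥ A *ᵥ x) (hK : K.IsSymm) (hRK : R * K = 1)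
    (hN : ∀ i j, |(A * K) i j - (1 : Matrix (Fin p) (Fin p) ℝ) i j| ≤ t) (ht : 0 ≤ t)
    (hb : ∀ j, ∑ k, |T k j - K k j| ≤ b)
    (hq : ∀ j, (fun k => T k j - K k j) ⬝ᵥ A *ᵥ (fun k => T k j - K k j) ≤ q) (i j : Fin p) :
    |((T + Tᵀ - Tᵀ * A * T - K) - (-(K * (A - R) * K))) i j| ≤ 2 * t * b + q := by
  rw [remainder_identity hA hK hRK]
  have e1 : ((T - K)ᵀ * (A * K - 1)) i j =
      (fun k => T k i - K k i) ⬝ᵥ fun k => (A * K) k j - (1 : Matrix (Fin p) (Fin p) ℝ) k j := rfl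
  have e2 : ((A * K - 1)ᵀ * (T - K) : Matrix (Fin p) (Fin p) ℝ) i j =
      (fun k => T k j - K k j) ⬝ᵥ fun k => (A * K) k i - (1 : Matrix (Fin p) (Fin p) ℝ) k i :=
    dotProduct_comm (fun k => (A * K) k i - (1 : Matrix (Fin p) (Fin p) ℝ) k i) _
  have e3 : ((T - K)ᵀ * (A * (T - K))) i j =
      (fun k => T k i - K k i) ⬝ᵥ A *ᵥ (fun k => T k j - K k j) := rfl
  have b1 := abs_dotProduct_le (x := fun k => T k i - K k i) (fun k => hN k j)
  have b2 := abs_dotProduct_le (x := fun k => T k j - K k j) (fun k => hN k i)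
  -- The form pairs two different columns; positivity of `A` reduces it to their two prediction
  -- errors.
  have b3 := two_mul_abs_bilin_le hA hpos (fun k => T k j - K k j) (fun k => T k i - K k i)
  have c1 := mul_le_mul_of_nonneg_left (hb i) ht
  have c2 := mul_le_mul_of_nonneg_left (hb j) ht
  rw [← e1] at b1
  rw [← e2] at b2
  rw [← e3] at b3
  rw [Matrix.sub_apply, Matrix.sub_apply, Matrix.neg_apply]
  have := hq i
  have := hq j
  rw [abs_le] at b1 b2 ⊢
  have b4 := (abs_le.1 (le_of_eq (rfl : |((T - K)ᵀ * (A * (T - K))) i j| = _)))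
  constructor <;> linarith [b1.1, b1.2, b2.1, b2.2, b4.1, b4.2]

end Deterministic

/-! ### The nodewise problems as minimization over contrasts. -/

section Estimator

variable {n p : ℕ}

theorem sampleCov_isSymm (X : Matrix (Fin n) (Fin p) ℝ) : (sampleCov X).IsSymm := by
  rw [sampleCov, IsSymm, transpose_smul, transpose_mul, transpose_transpose]

theorem quad_sampleCov (X : Matrix (Fin n) (Fin p) ℝ) (x : Fin p → ℝ) :
    x ⬝ᵥ sampleCov X *ᵥ x = (∑ i, (X *ᵥ x) i ^ 2) / n := by
  rw [sampleCov, smul_mulVec, dotProduct_smul, ← mulVec_mulVec, dotProduct_mulVec,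
    vecMul_transpose, smul_eq_mul, inv_mul_eq_div]
  simp [dotProduct, sq]

theorem quad_sampleCov_nonneg (X : Matrix (Fin n) (Fin p) ℝ) (x : Fin p → ℝ) :
    0 ≤ x ⬝ᵥ sampleCov X *ᵥ x := by
  rw [quad_sampleCov]
  exact div_nonneg (Finset.sum_nonneg fun _ _ => sq_nonneg _) (Nat.cast_nonneg n)

theorem sampleCov_standardize (X : Matrix (Fin n) (Fin p) ℝ) :
    sampleCov (standardize X) = sampleCorr X := by
  have h : (invStd (sampleCov X))ᵀ = invStd (sampleCov X) := diagonal_transpose _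
  rw [sampleCorr, corrMatrix]
  nth_rewrite 1 [sampleCov]
  nth_rewrite 2 [sampleCov]
  rw [standardize, transpose_mul, h, Matrix.mul_smul, Matrix.smul_mul]
  simp only [Matrix.mul_assoc]

/-- The vector `(1, -γ)` of the contrast `Z_j - Z_{-j} γ`. -/
def contrastVector (j : Fin p) (γ : {k : Fin p // k ≠ j} → ℝ) : Fin p → ℝ :=
  fun k => if h : k = j then 1 else -γ ⟨k, h⟩

theorem contrastVector_self (j : Fin p) (γ : {k : Fin p // k ≠ j} → ℝ) :
    contrastVector j γ j = 1 := by
  simp [contrastVector]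

theorem contrastVector_neg {j : Fin p} {v : Fin p → ℝ} (hv : v j = 1) :
    contrastVector j (fun k => -v k) = v := by
  ext k
  by_cases h : k = j
  · simp [contrastVector, h, hv]
  · simp [contrastVector, h]

/-- The node problem depends on the data only through the quadratic form of the Gram matrix,
evaluated at vectors with `j`-th entry 1. -/
theorem residualLevel_eq (Z : Matrix (Fin n) (Fin p) ℝ) (j : Fin p)
    (γ : {k : Fin p // k ≠ j} → ℝ) :
    residualLevel Z j γ = √(contrastVector j γ ⬝ᵥ sampleCov Z *ᵥ contrastVector j γ) := by
  rw [quad_sampleCov, Real.sqrt_div' _ (Nat.cast_nonneg n), residualLevel]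
  congr 3
  ext i
  congr 1
  rw [mulVec, dotProduct, Fintype.sum_eq_add_sum_subtype_ne _ j, contrastVector_self, mul_one,
    sub_eq_add_neg, ← Finset.sum_neg_distrib]
  congr 1
  refine Finset.sum_congr rfl fun k _ => ?_
  simp [contrastVector, k.2]

theorem sum_abs_contrastVector (j : Fin p) (γ : {k : Fin p // k ≠ j} → ℝ) :
    ∑ k, |γ k| = ∑ k, |contrastVector j γ k| - 1 := by
  rw [Fintype.sum_eq_add_sum_subtype_ne _ j, contrastVector_self, abs_one, add_sub_cancel_left]
  refine Finset.sum_congr rfl fun k _ => ?_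
  simp [contrastVector, k.2]

/-- The columns of a nodewise estimate in terms of the minimizing contrasts. -/
theorem IsNormalizedNodewise.exists_contrast {lam : ℝ} {X : Matrix (Fin n) (Fin p) ℝ}
    {T : Matrix (Fin p) (Fin p) ℝ} (h : IsNormalizedNodewise lam X T) (j : Fin p) :
    ∃ w : Fin p → ℝ, w j = 1 ∧
      (∀ v : Fin p → ℝ, v j = 1 → √(w ⬝ᵥ sampleCorr X *ᵥ w) + 2 * lam * ∑ k, |w k| ≤
        √(v ⬝ᵥ sampleCorr X *ᵥ v) + 2 * lam * ∑ k, |v k|) ∧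
      ∀ k, T k j = w k / (w ⬝ᵥ sampleCorr X *ᵥ w +
        lam * √(w ⬝ᵥ sampleCorr X *ᵥ w) * (∑ k, |w k| - 1)) := by
  obtain ⟨γ, hmin, rfl⟩ := h
  refine ⟨contrastVector j (γ j), contrastVector_self _ _, fun v hv => ?_, fun k => ?_⟩
  · have h1 := hmin j (Set.mem_univ fun k : {k : Fin p // k ≠ j} => -v k)
    simp only [Set.mem_ofPred_eq, objective] at h1
    rw [residualLevel_eq, residualLevel_eq, sum_abs_contrastVector, sum_abs_contrastVector,
      contrastVector_neg hv, sampleCov_standardize] at h1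
    linarith
  · have h1 : tauTildeSq lam (standardize X) j (γ j) =
        contrastVector j (γ j) ⬝ᵥ sampleCorr X *ᵥ contrastVector j (γ j) +
          lam * √(contrastVector j (γ j) ⬝ᵥ sampleCorr X *ᵥ contrastVector j (γ j)) *
            (∑ k, |contrastVector j (γ j) k| - 1) := by
      rw [tauTildeSq, residualLevel_eq, sum_abs_contrastVector, sampleCov_standardize,
        Real.sq_sqrt]
      rw [← sampleCov_standardize]
      exact quad_sampleCov_nonneg _ _
    rw [← h1]
    by_cases hk : k = j <;> simp [nodewiseMatrix, contrastVector, hk]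

end Estimator

/-! ### Remainder bounds on the event of close covariances. -/

section Deterministic

variable {n p : ℕ} {P : MeasureTheory.Measure (Fin p → ℝ)} {L u s lam η : ℝ}
  {X : Matrix (Fin n) (Fin p) ℝ} {T : Matrix (Fin p) (Fin p) ℝ}

/-- The event on which the sample covariance matrix is entrywise close to its expectation. -/
def CloseCov (P : MeasureTheory.Measure (Fin p → ℝ)) (u : ℝ) (X : Matrix (Fin n) (Fin p) ℝ) :
    Prop :=
  (∀ i j, |sampleCov X i j - covMatrix P i j| ≤ u) ∧
    ∀ i j, |(sampleCov X * precision P) i j - (1 : Matrix (Fin p) (Fin p) ℝ) i j| ≤ u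

theorem BoundedSpectrum.covMatrix_mul_precision (h : BoundedSpectrum P L) :
    covMatrix P * precision P = 1 :=
  mul_nonsing_inv _ ((isUnit_iff_isUnit_det _).1 h.1)

theorem trueCorr_mul_invCorr (h : BoundedSpectrum P L) (hL : 1 ≤ L) :
    trueCorr P * invCorr P = 1 :=
  corrMatrix_mul_inv (h.wellConditioned_covMatrix (by linarith)) hL h.covMatrix_mul_precision

theorem invCorr_isSymm (P : MeasureTheory.Measure (Fin p → ℝ)) : (invCorr P).IsSymm := by
  rw [invCorr, IsSymm, transpose_nonsing_inv, trueCorr,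
    (corrMatrix_isSymm (covMatrix_isSymm P)).eq]

theorem invCorr_eq_zero (h : BoundedSpectrum P L) (hL : 1 ≤ L) {k j : Fin p}
    (hk : precision P k j = 0) : invCorr P k j = 0 := by
  rw [invCorr, trueCorr, corrMatrix_inv_apply (h.wellConditioned_covMatrix (by linarith)) hL
    h.covMatrix_mul_precision, hk]
  ring

/-- The passage from the random event to the deterministic conditions. The constant `ρ = L²` arises
because rescaling costs a factor `L` in the spectral bounds; the entrywise perturbation of `R₀` is
charged to `t ‖x‖₁²` in the restricted eigenvalue bound. -/
theorem approxInverse_sampleCorr (h : BoundedSpectrum P L) (hL : 1 ≤ L) (hu : 0 ≤ u)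
    (hX : CloseCov P u X) (hs : 1 ≤ s)
    (hsupp : ∀ j, ∃ S : Finset (Fin p), (S.card : ℝ) ≤ s ∧ ∀ k ∉ S, precision P k j = 0)
    (hη : 12 * L ^ 5 * u ≤ η) (hsη : s * η ≤ 1 / (10000 * (L ^ 2) ^ 4)) :
    ApproxInverse (sampleCorr X) (invCorr P) (L ^ 2) (12 * L ^ 5 * u) s := by
  have hL0 : 0 < L := by linarith
  have hS := h.wellConditioned_covMatrix hL0
  have hT := h.wellConditioned_precision
  have hinv := h.covMatrix_mul_precision
  have huη : u ≤ η := by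
    refine le_trans (le_mul_of_one_le_left hu ?_) hη
    have := one_le_pow₀ hL (n := 5)
    linarith
  have hsu : s * u ≤ 1 / (10000 * (L ^ 2) ^ 4) := le_trans (by gcongr) hsη
  have h2L : 1 / (10000 * (L ^ 2) ^ 4) ≤ 1 / (2 * L) := by
    have : L ≤ (L ^ 2) ^ 4 := by
      rw [← pow_mul]
      exact le_self_pow₀ hL (by norm_num)
    gcongr
    norm_num
  have h2L1 : 1 / (2 * L) ≤ 1 := by rw [div_le_one (by positivity)]; linarith
  have hu2 : u ≤ 1 / (2 * L) := (le_mul_of_one_le_left hu hs).trans (hsu.trans h2L)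
  have hclose := abs_corrMatrix_sub_le hS hL hu2 hX.1
  have hnonneg : ∀ x, 0 ≤ x ⬝ᵥ sampleCorr X *ᵥ x := fun x => by
    rw [← sampleCov_standardize]
    exact quad_sampleCov_nonneg _ x
  have hl1 : ∀ (M : Matrix (Fin p) (Fin p) ℝ) (b : ℝ), (∀ j, ∑ i, M i j ^ 2 ≤ b) →
      (∀ k j, precision P k j = 0 → M k j = 0) → ∀ j, (∑ k, |M k j|) ^ 2 ≤ s * b := by
    intro M b hb hM j
    obtain ⟨S, hc, h0⟩ := hsupp j
    refine (sq_sum_abs_le_of_support (x := fun k => M k j) (S := S)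
      fun k hk => hM k j (h0 k hk)).trans ?_
    gcongr
    exact hb j
  refine ⟨one_le_pow₀ hL, hs, by positivity, corrMatrix_isSymm (sampleCov_isSymm X), hnonneg,
    fun x => ?_, ?_, fun j => (corrMatrix_inv_diag_bounds hS hT hL hinv j).1,
    fun j => (corrMatrix_inv_diag_bounds hS hT hL hinv j).2, ?_⟩
  · have h1 := corrMatrix_lower hS hL x
    have h2 := (abs_le.1 (abs_dotProduct_mulVec_le (E := corrMatrix (sampleCov X) -
      corrMatrix (covMatrix P)) hclose x)).1
    rw [sub_mulVec, dotProduct_sub] at h2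
    rw [sampleCorr]
    linarith
  · exact abs_corrMatrix_mul_inv_sub_one_le hS hT hL hinv hu2 hX.1 hX.2 hs
      ((hsu.trans h2L).trans h2L1)
      (hl1 _ _ (fun j => hT.sum_col_sq_le hL0 j) fun _ _ h => h)
  · exact hl1 _ _ (fun j => sum_corrMatrix_inv_sq_le hS hT hL hinv j)
      fun k j hk => invCorr_eq_zero h hL hk

/-- The hypothesis `0 ≤ b` covers `p = 0`, where the supremum takes its default value 0. -/
theorem supNorm_le {A : Matrix (Fin p) (Fin p) ℝ} {b : ℝ} (hb : 0 ≤ b)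
    (h : ∀ i j, |A i j| ≤ b) : supNorm A ≤ b :=
  Real.iSup_le (fun ij => h ij.1 ij.2) hb

theorem supNorm_remainder_le_of_columns {t b q ρ : ℝ} (h : BoundedSpectrum P L) (hL : 1 ≤ L)
    (hA : ApproxInverse (sampleCorr X) (invCorr P) ρ t s) (hb0 : 0 ≤ b) (hq0 : 0 ≤ q)
    (hb : ∀ j, ∑ k, |T k j - invCorr P k j| ≤ b)
    (hq : ∀ j, (fun k => T k j - invCorr P k j) ⬝ᵥ sampleCorr X *ᵥ
      (fun k => T k j - invCorr P k j) ≤ q) :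
    supNorm (remainder P X T) ≤ 2 * t * b + q := by
  have ht := hA.t_nonneg
  refine supNorm_le (by positivity) fun i j => ?_
  exact abs_remainder_le hA.isSymm hA.nonneg (invCorr_isSymm P) (trueCorr_mul_invCorr h hL)
    hA.noise ht hb hq i j

/-- Remainder bound from a compatibility condition on the estimation errors. -/
theorem supNorm_remainder_le_of_compatibility (h : BoundedSpectrum P L) (hL : 1 ≤ L)
    (hlam : 0 ≤ lam) (hη : lam + 12 * L ^ 5 * u ≤ η)
    (hsη : s * η ≤ 1 / (10000 * (L ^ 2) ^ 4))
    (hA : ApproxInverse (sampleCorr X) (invCorr P) (L ^ 2) (12 * L ^ 5 * u) s)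
    (hT : IsNormalizedNodewise lam X T)
    (hcomp : ∀ (j : Fin p) (w : Fin p → ℝ), w j = 1 →
      √(w ⬝ᵥ sampleCorr X *ᵥ w) + 2 * lam * ∑ k, |w k| ≤
        √(populationVector (invCorr P) j ⬝ᵥ sampleCorr X *ᵥ populationVector (invCorr P) j) +
          2 * lam * ∑ k, |populationVector (invCorr P) j k| →
      (∑ k, |w k - populationVector (invCorr P) j k|) ^ 2 ≤
        16 * s * ∑ k, (w k - populationVector (invCorr P) j k) ^ 2) :
    supNorm (remainder P X T) ≤ 30000 * L ^ 22 * (s * η ^ 2) := by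
  have hL0 : 0 < L := by linarith
  have hs := hA.one_le_s
  have ht := hA.t_nonneg
  have hη0 : 0 ≤ η := by linarith
  have hcol : ∀ j, ∑ k, |T k j - invCorr P k j| ≤ 520 * (L ^ 2) ^ 7 * (s * η) ∧
      (fun k => T k j - invCorr P k j) ⬝ᵥ sampleCorr X *ᵥ (fun k => T k j - invCorr P k j) ≤
        25000 * (L ^ 2) ^ 11 * (s * η ^ 2) := by
    intro j
    obtain ⟨w, hwj, hmin, hTw⟩ := hT.exists_contrast j
    have hm := hmin _ (hA.populationVector_self j)
    exact hA.column_error j hwj hm hη hsη hlam (hcomp j w hwj hm)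
      (u := fun k => T k j - invCorr P k j) fun k => by rw [hTw]
  refine (supNorm_remainder_le_of_columns h hL hA (by positivity) (by positivity)
    (fun j => (hcol j).1) fun j => (hcol j).2).trans ?_
  have e1 : L ^ 14 * (s * η ^ 2) ≤ L ^ 22 * (s * η ^ 2) := by
    gcongr ?_ * _
    exact pow_le_pow_right₀ hL (by norm_num)
  have e2 : 0 ≤ L ^ 22 * (s * η ^ 2) := by positivity
  calc 2 * (12 * L ^ 5 * u) * (520 * (L ^ 2) ^ 7 * (s * η)) + 25000 * (L ^ 2) ^ 11 * (s * η ^ 2)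
      ≤ 2 * η * (520 * (L ^ 2) ^ 7 * (s * η)) + 25000 * (L ^ 2) ^ 11 * (s * η ^ 2) := by
        gcongr
        linarith
    _ = 1040 * (L ^ 14 * (s * η ^ 2)) + 25000 * (L ^ 22 * (s * η ^ 2)) := by ring
    _ ≤ _ := by linarith

/-- Low-dimensional remainder bound: no relation between `λ` and the noise is needed. -/
theorem supNorm_remainder_le_of_dim_le (h : BoundedSpectrum P L) (hL : 1 ≤ L) (hu : 0 ≤ u)
    (hX : CloseCov P u X) (hs : 1 ≤ s) (hps : (p : ℝ) ≤ s) (hlam : 0 ≤ lam)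
    (hη : lam + 12 * L ^ 5 * u ≤ η) (hsη : s * η ≤ 1 / (10000 * (L ^ 2) ^ 4))
    (hT : IsNormalizedNodewise lam X T) :
    supNorm (remainder P X T) ≤ 30000 * L ^ 22 * (s * η ^ 2) := by
  have hA := approxInverse_sampleCorr h hL hu hX hs
    (fun j => ⟨Finset.univ, by simpa using hps, by simp⟩) (by linarith) hsη
  refine supNorm_remainder_le_of_compatibility h hL hlam hη hsη hA hT fun j w _ _ => ?_
  refine (sq_sum_abs_le_of_support (x := fun k => w k - populationVector (invCorr P) j k)
    (S := Finset.univ) (by simp)).trans ?_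
  gcongr
  simp only [Finset.card_univ, Fintype.card_fin]
  linarith

/-- The neighbours of the node `j` in the graph of the precision matrix. -/
noncomputable def neighbours (P : MeasureTheory.Measure (Fin p → ℝ)) (j : Fin p) :
    Finset (Fin p) :=
  (Set.toFinite {i : Fin p | i ≠ j ∧ precision P i j ≠ 0}).toFinset

theorem mem_neighbours {i j : Fin p} : i ∈ neighbours P j ↔ i ≠ j ∧ precision P i j ≠ 0 := by
  simp [neighbours]

theorem card_neighbours_le (P : MeasureTheory.Measure (Fin p → ℝ)) (j : Fin p) :
    (neighbours P j).card ≤ maxDegree P := by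
  rw [neighbours, ← Set.ncard_eq_toFinset_card]
  exact Finset.le_sup (f := fun j : Fin p => Set.ncard {i : Fin p | i ≠ j ∧ precision P i j ≠ 0})
    (Finset.mem_univ j)

theorem approxInverse_of_maxDegree (h : BoundedSpectrum P L) (hL : 1 ≤ L) (hu : 0 ≤ u)
    (hX : CloseCov P u X) (hη : 12 * L ^ 5 * u ≤ η)
    (hsη : (maxDegree P + 1) * η ≤ 1 / (10000 * (L ^ 2) ^ 4)) :
    ApproxInverse (sampleCorr X) (invCorr P) (L ^ 2) (12 * L ^ 5 * u) (maxDegree P + 1) := by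
  refine approxInverse_sampleCorr h hL hu hX (by simp)
    (fun j => ⟨insert j (neighbours P j), ?_, fun k hk => ?_⟩) hη hsη
  · exact_mod_cast (Finset.card_insert_le _ _).trans
      (Nat.add_le_add_right (card_neighbours_le P j) 1)
  · simp only [Finset.mem_insert, mem_neighbours, not_or, not_and, not_not] at hk
    exact hk.2 hk.1

theorem l1_error_le_neighbours (h : BoundedSpectrum P L) (hL : 1 ≤ L)
    (hA : ApproxInverse (sampleCorr X) (invCorr P) (L ^ 2) (12 * L ^ 5 * u) s)
    (hlam : 0 < lam) (hη : lam + 12 * L ^ 5 * u ≤ η) (hnoise : 48 * L ^ 9 * u ≤ lam)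
    (hsη : s * η ≤ 1 / (10000 * (L ^ 2) ^ 4)) {j : Fin p} {w : Fin p → ℝ} (hwj : w j = 1)
    (hm : √(w ⬝ᵥ sampleCorr X *ᵥ w) + 2 * lam * ∑ k, |w k| ≤
      √(populationVector (invCorr P) j ⬝ᵥ sampleCorr X *ᵥ populationVector (invCorr P) j) +
        2 * lam * ∑ k, |populationVector (invCorr P) j k|) :
    ∑ k, |w k - populationVector (invCorr P) j k| ≤
      4 * ∑ k ∈ neighbours P j, |w k - populationVector (invCorr P) j k| := by
  refine hA.l1_error_le_support j hwj hm (by linarith) hsη hlam (by linarith) fun k hk hkj => ?_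
  refine invCorr_eq_zero h hL ?_
  by_contra h0
  exact hk (mem_neighbours.2 ⟨hkj, h0⟩)

/-- Sparse remainder bound. -/
theorem supNorm_remainder_le_of_maxDegree (h : BoundedSpectrum P L) (hL : 1 ≤ L) (hu : 0 ≤ u)
    (hX : CloseCov P u X) (hlam : 0 < lam) (hη : lam + 12 * L ^ 5 * u ≤ η)
    (hnoise : 48 * L ^ 9 * u ≤ lam)
    (hsη : (maxDegree P + 1) * η ≤ 1 / (10000 * (L ^ 2) ^ 4))
    (hT : IsNormalizedNodewise lam X T) :
    supNorm (remainder P X T) ≤ 30000 * L ^ 22 * ((maxDegree P + 1) * η ^ 2) := by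
  have hA := approxInverse_of_maxDegree h hL hu hX (by linarith) hsη
  refine supNorm_remainder_le_of_compatibility h hL hlam.le hη hsη hA hT fun j w hwj hm => ?_
  have hcone := l1_error_le_neighbours h hL hA hlam hη hnoise hsη hwj hm
  set e : Fin p → ℝ := fun k => w k - populationVector (invCorr P) j k with he
  have h0 : 0 ≤ ∑ k, |e k| := Finset.sum_nonneg fun _ _ => abs_nonneg _
  have hcs := sq_sum_le_card_mul_sum_sq (s := neighbours P j) (f := fun k => |e k|)
  simp only [sq_abs] at hcs
  have hsub : ∑ k ∈ neighbours P j, e k ^ 2 ≤ ∑ k, e k ^ 2 :=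
    Finset.sum_le_sum_of_subset_of_nonneg (Finset.subset_univ _) fun _ _ _ => sq_nonneg _
  have hcard : ((neighbours P j).card : ℝ) ≤ maxDegree P + 1 := by
    have : ((neighbours P j).card : ℝ) ≤ maxDegree P := by exact_mod_cast card_neighbours_le P j
    linarith
  calc (∑ k, |e k|) ^ 2 ≤ (4 * ∑ k ∈ neighbours P j, |e k|) ^ 2 := by gcongr
    _ = 16 * (∑ k ∈ neighbours P j, |e k|) ^ 2 := by ring
    _ ≤ 16 * ((maxDegree P + 1) * ∑ k, e k ^ 2) := by
      gcongr
      exact hcs.trans (by gcongr)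
    _ = _ := by ring

/-- For a diagonal precision matrix all regressions are estimated by zero. -/
theorem supNorm_remainder_of_maxDegree_eq_zero (h : BoundedSpectrum P L) (hL : 1 ≤ L)
    (hu : 0 ≤ u) (hX : CloseCov P u X) (hlam : 0 < lam) (hη : lam + 12 * L ^ 5 * u ≤ η)
    (hnoise : 48 * L ^ 9 * u ≤ lam) (hd : maxDegree P = 0)
    (hηs : η ≤ 1 / (10000 * (L ^ 2) ^ 4)) (hT : IsNormalizedNodewise lam X T) :
    supNorm (remainder P X T) ≤ 0 := by
  have hL0 : 0 < L := by linarith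
  have hS := h.wellConditioned_covMatrix hL0
  have hsη : ((maxDegree P : ℝ) + 1) * η ≤ 1 / (10000 * (L ^ 2) ^ 4) := by simpa [hd] using hηs
  have hA := approxInverse_of_maxDegree h hL hu hX (by linarith) hsη
  have hoff : ∀ k j, k ≠ j → invCorr P k j = 0 := by
    intro k j hkj
    refine invCorr_eq_zero h hL ?_
    by_contra h0
    have h1 := card_neighbours_le P j
    rw [hd, Nat.le_zero, Finset.card_eq_zero] at h1
    have h2 : k ∈ neighbours P j := mem_neighbours.2 ⟨hkj, h0⟩
    simp [h1] at h2
  have hdiag : ∀ j, invCorr P j j = 1 := by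
    intro j
    have h1 := congrFun (congrFun (trueCorr_mul_invCorr h hL) j) j
    rw [mul_apply, Finset.sum_eq_single j (fun k _ hk => by rw [hoff k j hk, mul_zero])
      (by simp), trueCorr, corrMatrix_diag (lt_of_lt_of_le (by positivity)
        (hS.one_div_le_diag j)), one_mul, one_apply_eq] at h1
    exact h1
  have hK : ∀ k j, invCorr P k j = (Pi.single j (1 : ℝ) : Fin p → ℝ) k := by
    intro k j
    rcases eq_or_ne k j with rfl | hkj
    · simp [hdiag]
    · simp [hoff k j hkj, hkj]
  have hpop : ∀ j, populationVector (invCorr P) j = Pi.single j (1 : ℝ) := by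
    intro j
    ext k
    simp [populationVector, hdiag, hK]
  have hSjj : ∀ j, 0 < sampleCov X j j := by
    intro j
    have h1 := diag_pos_of_abs_sub_le (u := u) hS hL ?_ hX.1 j
    · exact lt_of_lt_of_le (by positivity) h1
    · have e1 : u ≤ 12 * L ^ 5 * u := le_mul_of_one_le_left hu (by
        have := one_le_pow₀ hL (n := 5)
        linarith)
      have h2L : 1 / (10000 * (L ^ 2) ^ 4) ≤ 1 / (2 * L) := by
        have : L ≤ (L ^ 2) ^ 4 := by
          rw [← pow_mul]
          exact le_self_pow₀ hL (by norm_num)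
        gcongr
        norm_num
      linarith
  have hTK : ∀ k j, T k j - invCorr P k j = 0 := by
    intro k j
    obtain ⟨w, hwj, hmin, hTw⟩ := hT.exists_contrast j
    -- Over an empty neighbourhood the cone condition says that the ℓ₁ error is at most 0.
    have hcone := l1_error_le_neighbours h hL hA hlam hη hnoise hsη hwj
      (hmin _ (hA.populationVector_self j))
    have h1 := card_neighbours_le P j
    rw [hd, Nat.le_zero, Finset.card_eq_zero] at h1
    rw [h1, Finset.sum_empty, mul_zero] at hcone
    have hw : w = Pi.single j (1 : ℝ) := by
      ext k
      have h2 := (Finset.single_le_sum (fun k _ => abs_nonneg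
        (w k - populationVector (invCorr P) j k)) (Finset.mem_univ k)).trans hcone
      rw [← hpop]
      exact sub_eq_zero.1 (abs_eq_zero.1 (le_antisymm h2 (abs_nonneg _)))
    -- `R̂` has unit diagonal and the penalty of `e_j` is zero, so `τ̃_j²` is exactly 1, matching
    -- the diagonal of `K₀`.
    have hq : w ⬝ᵥ sampleCorr X *ᵥ w = 1 := by
      rw [hw, sampleCorr]
      simpa using corrMatrix_diag (hSjj j)
    have hl : ∑ k, |w k| = 1 := by
      rw [hw]
      simp [Pi.single_apply, apply_ite abs]
    rw [hTw, hq, hl, hK, hw]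
    simp
  have := supNorm_remainder_le_of_columns (T := T) h hL hA le_rfl le_rfl
    (fun j => by simp [hTK]) (fun j => by simp [hTK])
  simpa using this

end Deterministic

/-! ### Probability of the good event. -/

section Probability

variable {n p : ℕ} {P : Measure (Fin p → ℝ)} [IsProbabilityMeasure P] {L K u : ℝ}
  {Ω : Type*} [MeasurableSpace Ω] {μ : Measure Ω} {X : Fin n → Ω → Fin p → ℝ}

theorem measureReal_abs_sampleCov_sub_le (hsg : SubGaussianVector P K) (hK : 0 < K)
    (hm : ∀ j, ∫ x, x j ∂P = 0) (hX : ∀ i, HasLaw (X i) P μ) (hindep : iIndepFun X μ)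
    (hn : 0 < n) (hu0 : 0 ≤ u) (hu : u ≤ 16 * K ^ 2) (i j : Fin p) :
    μ.real {ω | u ≤ |sampleCov (Matrix.of fun i => X i ω) i j - covMatrix P i j|} ≤
      2 * Real.exp (-(n * (u ^ 2 / (64 * K ^ 4)))) := by
  have h := hsg.measureReal_bilin_le hK hm hX hindep hn (sum_single_sq i) (sum_single_sq j) hu0 hu
  simpa using h

/-- Concentration is applied to `e_i` and the normalized `j`-th column of `Θ₀`. Only the ℓ₂ norm of
that column, at most `L`, is lost, not its ℓ₁ norm. -/
theorem measureReal_abs_sampleCov_mul_precision_sub_le (hb : BoundedSpectrum P L) (hL : 1 ≤ L)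
    (hsg : SubGaussianVector P K) (hK : 0 < K)
    (hm : ∀ j, ∫ x, x j ∂P = 0) (hX : ∀ i, HasLaw (X i) P μ) (hindep : iIndepFun X μ)
    (hn : 0 < n) (hu0 : 0 ≤ u) (hu : u ≤ 16 * K ^ 2) (i j : Fin p) :
    μ.real {ω | L * u ≤ |(sampleCov (Matrix.of fun i => X i ω) * precision P) i j -
      (1 : Matrix (Fin p) (Fin p) ℝ) i j|} ≤ 2 * Real.exp (-(n * (u ^ 2 / (64 * K ^ 4)))) := by
  have := hindep.isProbabilityMeasure
  have hL0 : 0 < L := by linarith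
  have hT := hb.wellConditioned_precision
  set r := √(∑ k, precision P k j ^ 2) with hr
  have hsum : 0 < ∑ k, precision P k j ^ 2 := by
    have h1 := hT.one_div_le_diag j
    have h2 : 0 < precision P j j := lt_of_lt_of_le (by positivity) h1
    refine lt_of_lt_of_le (pow_pos h2 2) ?_
    exact Finset.single_le_sum (f := fun k => precision P k j ^ 2) (fun k _ => sq_nonneg _)
      (Finset.mem_univ j)
  have hr0 : 0 < r := Real.sqrt_pos.2 hsum
  have hrL : r ≤ L := by
    rw [hr, Real.sqrt_le_left hL0.le]
    exact hT.sum_col_sq_le hL0 j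
  set w : Fin p → ℝ := r⁻¹ • fun k => precision P k j with hw
  have hw1 : ∑ k, w k ^ 2 = 1 := by
    simp only [hw, Pi.smul_apply, smul_eq_mul, mul_pow, ← Finset.mul_sum]
    rw [inv_pow, hr, Real.sq_sqrt hsum.le, inv_mul_cancel₀ hsum.ne']
  have hbil : ∀ M : Matrix (Fin p) (Fin p) ℝ, (Pi.single i (1 : ℝ) : Fin p → ℝ) ⬝ᵥ M *ᵥ w =
      r⁻¹ * (M * precision P) i j := by
    intro M
    rw [hw, mulVec_smul, dotProduct_smul, single_one_dotProduct, smul_eq_mul]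
    rfl
  have h := hsg.measureReal_bilin_le hK hm hX hindep hn (sum_single_sq i) hw1 hu0 hu
  refine (measureReal_mono ?_).trans h
  intro ω hω
  rw [Set.mem_ofPred_eq] at hω ⊢
  rw [hbil, hbil, hb.covMatrix_mul_precision, ← mul_sub, abs_mul, abs_of_pos (inv_pos.2 hr0),
    inv_mul_eq_div, le_div_iff₀ hr0]
  refine le_trans ?_ hω
  rw [mul_comm]
  gcongr

/-- With high probability the sample covariance matrix is entrywise close to its expectation. -/
theorem measureReal_not_closeCov_le (hb : BoundedSpectrum P L) (hL : 1 ≤ L)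
    (hsg : SubGaussianVector P K) (hK : 0 < K)
    (hm : ∀ j, ∫ x, x j ∂P = 0) (hX : ∀ i, HasLaw (X i) P μ) (hindep : iIndepFun X μ)
    (hn : 0 < n) (hu0 : 0 ≤ u) (hu : u ≤ 16 * K ^ 2) :
    μ.real {ω | ¬ CloseCov P (L * u) (Matrix.of fun i => X i ω)} ≤
      4 * p ^ 2 * Real.exp (-(n * (u ^ 2 / (64 * K ^ 4)))) := by
  have := hindep.isProbabilityMeasure
  set q := Real.exp (-(n * (u ^ 2 / (64 * K ^ 4))))
  set F : Fin p × Fin p → Set Ω := fun ij =>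
    {ω | u ≤ |sampleCov (Matrix.of fun i => X i ω) ij.1 ij.2 - covMatrix P ij.1 ij.2|} ∪
    {ω | L * u ≤ |(sampleCov (Matrix.of fun i => X i ω) * precision P) ij.1 ij.2 -
      (1 : Matrix (Fin p) (Fin p) ℝ) ij.1 ij.2|} with hF
  have hFle : ∀ ij, μ.real (F ij) ≤ 4 * q := fun ij => by
    refine (measureReal_union_le _ _).trans ?_
    have h1 := measureReal_abs_sampleCov_sub_le hsg hK hm hX hindep hn hu0 hu ij.1 ij.2
    have h2 := measureReal_abs_sampleCov_mul_precision_sub_le hb hL hsg hK hm hX hindep hn hu0 hu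
      ij.1 ij.2
    linarith
  have hsub : {ω | ¬ CloseCov P (L * u) (Matrix.of fun i => X i ω)} ⊆ ⋃ ij, F ij := by
    intro ω hω
    by_contra hcon
    simp only [Set.mem_iUnion, hF, Set.mem_union, Set.mem_ofPred_eq, not_exists, not_or,
      not_le] at hcon
    refine hω ⟨fun i j => ?_, fun i j => (hcon (i, j)).2.le⟩
    exact (hcon (i, j)).1.le.trans (le_mul_of_one_le_left hu0 hL)
  calc μ.real {ω | ¬ CloseCov P (L * u) (Matrix.of fun i => X i ω)}
      ≤ μ.real (⋃ ij, F ij) := measureReal_mono hsub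
    _ ≤ ∑ ij, μ.real (F ij) := measureReal_iUnion_fintype_le _
    _ ≤ ∑ _ij : Fin p × Fin p, 4 * q := Finset.sum_le_sum fun ij _ => hFle ij
    _ = 4 * p ^ 2 * q := by simp; ring

/-- Transfer of a bound that holds on the good event to a probability bound. -/
theorem measure_remainder_le {lam ε δ : ℝ} {T : Ω → Matrix (Fin p) (Fin p) ℝ}
    (hb : BoundedSpectrum P L) (hL : 1 ≤ L) (hsg : SubGaussianVector P K) (hK : 0 < K)
    (hm : ∀ j, ∫ x, x j ∂P = 0) (hX : ∀ i, HasLaw (X i) P μ) (hindep : iIndepFun X μ)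
    (hT : ∀ᵐ ω ∂μ, IsNormalizedNodewise lam (Matrix.of fun i => X i ω) (T ω))
    (hn : 0 < n) (hu0 : 0 ≤ u) (hu : u ≤ 16 * K ^ 2)
    (hδ : 4 * p ^ 2 * Real.exp (-(n * (u ^ 2 / (64 * K ^ 4)))) ≤ δ)
    (hdet : ∀ ω, CloseCov P (L * u) (Matrix.of fun i => X i ω) →
      IsNormalizedNodewise lam (Matrix.of fun i => X i ω) (T ω) →
      √(n : ℝ) * supNorm (remainder P (Matrix.of fun i => X i ω) (T ω)) ≤ ε) :
    μ {ω | ε < √(n : ℝ) * supNorm (remainder P (Matrix.of fun i => X i ω) (T ω))} ≤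
      ENNReal.ofReal δ := by
  have := hindep.isProbabilityMeasure
  have h1 := (measureReal_not_closeCov_le hb hL hsg hK hm hX hindep hn hu0 hu).trans hδ
  -- Almost everywhere inclusion in the failure event suffices, so the estimator need not be
  -- measurable.
  refine le_trans (measure_mono_ae ?_) (ENNReal.le_ofReal_iff_toReal_le (measure_ne_top μ _)
    (measureReal_nonneg.trans h1) |>.2 h1)
  filter_upwards [hT] with ω hω h2 hclose
  exact absurd (hdet ω hclose hω) (not_le.2 h2)

end Probability

/-! ### High-dimensional and bounded-dimensional regimes. -/

section Regimes

variable {n p : ℕ} {P : Measure (Fin p → ℝ)} [IsProbabilityMeasure P] {L K C lam ε : ℝ}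
  {Ω : Type*} [MeasurableSpace Ω] {μ : Measure Ω} {X : Fin n → Ω → Fin p → ℝ}
  {T : Ω → Matrix (Fin p) (Fin p) ℝ}

/-- The high-dimensional regime: `λ` dominates the noise. -/
theorem measure_remainder_le_of_sparse {a : ℝ}
    (hb : BoundedSpectrum P L) (hL : 1 ≤ L) (hsg : SubGaussianVector P K) (hK : 0 < K)
    (hm : ∀ j, ∫ x, x j ∂P = 0) (hX : ∀ i, HasLaw (X i) P μ) (hindep : iIndepFun X μ)
    (hT : ∀ᵐ ω ∂μ, IsNormalizedNodewise lam (Matrix.of fun i => X i ω) (T ω))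
    (hn : 0 < n) (hp : 1 ≤ Real.log p) (hC : 0 < C)
    (hlam1 : 768 * L ^ 10 * K ^ 2 * √(Real.log p / n) ≤ lam)
    (hlam2 : lam ≤ C * √(Real.log p / n)) (ha : 0 < a)
    (hlog : Real.log p ≤ a ^ 2 * n) (hd : maxDegree P * Real.log p ≤ a * √n)
    (ha1 : 4 * C * a ≤ 1 / (10000 * (L ^ 2) ^ 4)) (ha2 : C * a ≤ 16 * K ^ 2)
    (ha3 : 240000 * L ^ 22 * C ^ 2 * a ≤ ε) (hε : 0 ≤ ε) :
    μ {ω | ε < √(n : ℝ) * supNorm (remainder P (Matrix.of fun i => X i ω) (T ω))} ≤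
      ENNReal.ofReal (4 / p) := by
  have hn' : (0 : ℝ) < n := by exact_mod_cast hn
  have hsn : 0 < √(n : ℝ) := Real.sqrt_pos.2 hn'
  have hlogp : 0 < Real.log p := by linarith
  have hp0 : (0 : ℝ) < p := by
    rcases Nat.eq_zero_or_pos p with h | h
    · simp [h] at hlogp
    · exact_mod_cast h
  have hp1 : (1 : ℝ) ≤ p := by
    have : 1 ≤ p := by exact_mod_cast hp0
    exact_mod_cast this
  set ℓ := √(Real.log p / n) with hℓ
  have hℓ0 : 0 < ℓ := Real.sqrt_pos.2 (by positivity)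
  have hℓ2 : ℓ ^ 2 = Real.log p / n := Real.sq_sqrt (by positivity)
  have hℓa : ℓ ≤ a := by
    rw [hℓ, Real.sqrt_le_left ha.le, div_le_iff₀ hn']
    exact hlog
  have hd0 : (0 : ℝ) ≤ maxDegree P := Nat.cast_nonneg _
  have hdℓ2 : √(n : ℝ) * (maxDegree P * ℓ ^ 2) ≤ a := by
    rw [hℓ2]
    have e : √(n : ℝ) * (maxDegree P * (Real.log p / n)) = maxDegree P * Real.log p / √n := by
      have := Real.sq_sqrt hn'.le
      field_simp
      linear_combination (maxDegree P : ℝ) * this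
    rw [e, div_le_iff₀ hsn]
    exact hd
  have hdℓ : maxDegree P * ℓ ≤ a := by
    -- `√(log p) ≤ log p` because `log p ≥ 1`.
    have h1 : ℓ ≤ Real.log p / √n := by
      rw [hℓ, Real.sqrt_div hlogp.le]
      gcongr
      rw [Real.sqrt_le_left hlogp.le]
      nlinarith
    calc maxDegree P * ℓ ≤ maxDegree P * (Real.log p / √n) := by gcongr
      _ = maxDegree P * Real.log p / √n := by ring
      _ ≤ a := by rwa [div_le_iff₀ hsn]
  have hlam : 0 < lam := lt_of_lt_of_le (by positivity) hlam1
  -- The largest `u` for which the noise `t = 12 L⁵ (L u)` meets the cone requirement `4 ρ² t ≤ λ`.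
  -- Together with `u ≥ 16 K² √(log p / n)` this produces the constant `768 L¹⁰ K²`.
  set u := lam / (48 * L ^ 10) with hu
  have hu0 : 0 ≤ u := by positivity
  have hulam : 48 * L ^ 10 * u = lam := by
    rw [hu]; field_simp
  have hL10 : 1 ≤ L ^ 10 := one_le_pow₀ hL
  have hule : u ≤ lam := by
    rw [← hulam]
    exact le_mul_of_one_le_left hu0 (by linarith)
  have hη : lam + 12 * L ^ 5 * (L * u) ≤ 2 * lam := by
    have h1 : L ^ 6 * u ≤ L ^ 10 * u := by
      gcongr ?_ * _
      exact pow_le_pow_right₀ hL (by norm_num)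
    have h2 : 12 * L ^ 5 * (L * u) = 12 * (L ^ 6 * u) := by ring
    have h3 : 0 ≤ L ^ 10 * u := by positivity
    linarith
  have hnoise : 48 * L ^ 9 * (L * u) ≤ lam := le_of_eq (by rw [← hulam]; ring)
  have hlama : lam ≤ C * a := hlam2.trans (by gcongr)
  have hsη : ((maxDegree P : ℝ) + 1) * (2 * lam) ≤ 1 / (10000 * (L ^ 2) ^ 4) := by
    refine le_trans ?_ ha1
    have h1 : maxDegree P * lam ≤ C * a := by
      calc maxDegree P * lam ≤ maxDegree P * (C * ℓ) := by gcongr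
        _ = C * (maxDegree P * ℓ) := by ring
        _ ≤ C * a := by gcongr
    linarith
  refine measure_remainder_le hb hL hsg hK hm hX hindep hT hn hu0 (hule.trans (hlama.trans ha2))
    ?_ fun ω hclose hω => ?_
  · have hexp : 4 * Real.log p ≤ n * (u ^ 2 / (64 * K ^ 4)) := by
      have h1 : 16 * K ^ 2 * ℓ ≤ u := by
        rw [hu, le_div_iff₀ (by positivity)]
        calc 16 * K ^ 2 * ℓ * (48 * L ^ 10) = 768 * L ^ 10 * K ^ 2 * ℓ := by ring
          _ ≤ lam := hlam1
      have h2 : (16 * K ^ 2 * ℓ) ^ 2 ≤ u ^ 2 := by gcongr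
      calc 4 * Real.log p = n * ((16 * K ^ 2 * ℓ) ^ 2 / (64 * K ^ 4)) := by
            rw [mul_pow, hℓ2]; field_simp; ring
        _ ≤ _ := by gcongr
    have h3 : Real.exp (-(n * (u ^ 2 / (64 * K ^ 4)))) ≤ ((p : ℝ) ^ 4)⁻¹ := by
      calc Real.exp (-(n * (u ^ 2 / (64 * K ^ 4)))) ≤ Real.exp (-(4 * Real.log p)) := by gcongr
        _ = ((p : ℝ) ^ 4)⁻¹ := by
          rw [Real.exp_neg, show (4 : ℝ) * Real.log p = ((4 : ℕ) : ℝ) * Real.log p by norm_num,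
            Real.exp_nat_mul, Real.exp_log hp0]
    calc 4 * (p : ℝ) ^ 2 * Real.exp (-(n * (u ^ 2 / (64 * K ^ 4))))
        ≤ 4 * (p : ℝ) ^ 2 * ((p : ℝ) ^ 4)⁻¹ := by gcongr
      _ = 4 / (p : ℝ) ^ 2 := by field_simp
      _ ≤ 4 / p := by
        gcongr
        exact le_self_pow₀ hp1 (by norm_num)
  · rcases Nat.eq_zero_or_pos (maxDegree P) with hd1 | hd1
    · have h := supNorm_remainder_of_maxDegree_eq_zero hb hL (by positivity) hclose hlam hη hnoise
        hd1 (by simpa [hd1] using hsη) hω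
      exact (mul_nonpos_of_nonneg_of_nonpos hsn.le h).trans hε
    · have h := supNorm_remainder_le_of_maxDegree hb hL (by positivity) hclose hlam hη hnoise hsη hω
      have hd2 : (1 : ℝ) ≤ maxDegree P := by exact_mod_cast hd1
      refine le_trans ?_ ha3
      calc √(n : ℝ) * supNorm (remainder P (Matrix.of fun i => X i ω) (T ω))
          ≤ √(n : ℝ) * (30000 * L ^ 22 * ((maxDegree P + 1) * (2 * lam) ^ 2)) := by gcongr
        _ ≤ √(n : ℝ) * (30000 * L ^ 22 * ((maxDegree P + maxDegree P) * (2 * (C * ℓ)) ^ 2)) := by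
          gcongr
        _ = 240000 * L ^ 22 * C ^ 2 * (√(n : ℝ) * (maxDegree P * ℓ ^ 2)) := by ring
        _ ≤ 240000 * L ^ 22 * C ^ 2 * a := by gcongr

/-- The low-dimensional regime: `λ` is of the order of the noise, but need not dominate it. -/
theorem measure_remainder_le_of_dim {B M D : ℝ}
    (hb : BoundedSpectrum P L) (hL : 1 ≤ L) (hsg : SubGaussianVector P K) (hK : 0 < K)
    (hm : ∀ j, ∫ x, x j ∂P = 0) (hX : ∀ i, HasLaw (X i) P μ) (hindep : iIndepFun X μ)
    (hT : ∀ᵐ ω ∂μ, IsNormalizedNodewise lam (Matrix.of fun i => X i ω) (T ω))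
    (hn : 0 < n) (hB : 1 ≤ B) (hp : (p : ℝ) ≤ B) (hM : 0 ≤ M)
    (hlam0 : 0 ≤ lam) (hD : lam + 12 * L ^ 6 * (M / √n) ≤ D / √n)
    (hD1 : B * (D / √n) ≤ 1 / (10000 * (L ^ 2) ^ 4)) (hM1 : M / √n ≤ 16 * K ^ 2)
    (hD2 : 30000 * L ^ 22 * B * D ^ 2 / √n ≤ ε) :
    μ {ω | ε < √(n : ℝ) * supNorm (remainder P (Matrix.of fun i => X i ω) (T ω))} ≤
      ENNReal.ofReal (4 * B ^ 2 * Real.exp (-(M ^ 2 / (64 * K ^ 4)))) := by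
  have hn' : (0 : ℝ) < n := by exact_mod_cast hn
  have hsn : 0 < √(n : ℝ) := Real.sqrt_pos.2 hn'
  have hsq := Real.sq_sqrt hn'.le
  refine measure_remainder_le hb hL hsg hK hm hX hindep hT hn (u := M / √n) (by positivity) hM1
    ?_ fun ω hclose hω => ?_
  · have e : n * ((M / √n) ^ 2 / (64 * K ^ 4)) = M ^ 2 / (64 * K ^ 4) := by
      rw [div_pow, hsq]; field_simp
    rw [e]
    gcongr
  · have h := supNorm_remainder_le_of_dim_le hb hL (by positivity) hclose hB hp hlam0
      (η := D / √n) (le_trans (le_of_eq (by ring)) hD) hD1 hω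
    refine le_trans ?_ hD2
    calc √(n : ℝ) * supNorm (remainder P (Matrix.of fun i => X i ω) (T ω))
        ≤ √(n : ℝ) * (30000 * L ^ 22 * (B * (D / √n) ^ 2)) := by gcongr
      _ = 30000 * L ^ 22 * B * D ^ 2 / √n := by field_simp

end Regimes

theorem exists_exp_neg_sq_le {b c δ : ℝ} (hc : 0 < c) (hδ : 0 < δ) :
    ∃ M : ℝ, 0 ≤ M ∧ b * Real.exp (-(M ^ 2 / c)) ≤ δ := by
  have h : Tendsto (fun M : ℝ => b * Real.exp (-(M ^ 2 / c))) atTop (𝓝 (b * 0)) :=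
    (Real.tendsto_exp_neg_atTop_nhds_zero.comp
      ((tendsto_pow_atTop two_ne_zero).atTop_div_const hc)).const_mul b
  rw [mul_zero] at h
  obtain ⟨M, h1, h2⟩ := ((h.eventually (ge_mem_nhds hδ)).and (eventually_ge_atTop 0)).exists
  exact ⟨M, h2, h1⟩

theorem eventually_div_sqrt_le (x : ℝ) {y : ℝ} (hy : 0 < y) :
    ∀ᶠ n : ℕ in atTop, x / √(n : ℝ) ≤ y :=
  ((tendsto_const_nhds (x := x)).div_atTop
    (Real.tendsto_sqrt_atTop.comp tendsto_natCast_atTop_atTop)).eventually (ge_mem_nhds hy)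

end NodewiseSqrtLasso

/-! ### Assembly of the two regimes. -/

theorem mainTheorem8 (L K : ℝ) (hL : 1 ≤ L) (hK : 0 < K) :
    ∃ c₀ : ℝ, 0 < c₀ ∧
      ∀ (C : ℝ) (p : ℕ → ℕ) (P : (n : ℕ) → Measure (Fin (p n) → ℝ))
        (Ω : ℕ → Type*) [∀ n, MeasurableSpace (Ω n)]
        (μ : (n : ℕ) → Measure (Ω n)) [∀ n, IsProbabilityMeasure (μ n)]
        (X : (n : ℕ) → Fin n → Ω n → (Fin (p n) → ℝ))
        (lam : ℕ → ℝ)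
        (Θhat : (n : ℕ) → Ω n → Matrix (Fin (p n)) (Fin (p n)) ℝ),
        -- the model: centered, bounded spectrum, sub-Gaussian
        (∀ n, IsProbabilityMeasure (P n)) →
        (∀ n j, ∫ x, x j ∂(P n) = 0) →
        (∀ n, NodewiseSqrtLasso.BoundedSpectrum (P n) L) →
        (∀ n, NodewiseSqrtLasso.SubGaussianVector (P n) K) →
        -- the observations are i.i.d. with law `P n`
        (∀ n i, HasLaw (X n i) (P n) (μ n)) →
        (∀ n, iIndepFun (X n) (μ n)) →
        -- `λ ≍ √(log p / n)`
        (∀ᶠ n in atTop, c₀ * √(Real.log (p n) / n) ≤ lam n ∧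
          lam n ≤ C * √(Real.log (p n) / n)) →
        -- `d = o(√n / log p)` and `log p = o(n)`
        ((fun n => (NodewiseSqrtLasso.maxDegree (P n) : ℝ)) =o[atTop]
          fun n => √(n : ℝ) / Real.log (p n)) →
        ((fun n => Real.log (p n)) =o[atTop] fun n => (n : ℝ)) →
        -- `Θhat` is a normalized nodewise square-root Lasso estimator
        (∀ᶠ n in atTop, ∀ᵐ ω ∂(μ n), NodewiseSqrtLasso.IsNormalizedNodewise (lam n)
          (Matrix.of fun i => X n i ω) (Θhat n ω)) →
        -- `‖rem‖_∞ = o_P(1/√n)`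
        ∀ ε : ℝ, 0 < ε →
          Tendsto (fun n => μ n {ω | ε < √(n : ℝ) * NodewiseSqrtLasso.supNorm
            (NodewiseSqrtLasso.remainder (P n) (Matrix.of fun i => X n i ω) (Θhat n ω))})
            atTop (𝓝 0) := by
  refine ⟨768 * L ^ 10 * K ^ 2, by positivity, ?_⟩
  intro C p P Ω _ μ _ X lam Θhat hP hm hb hsg hX hindep hlam hd hlog hT ε hε
  rw [ENNReal.tendsto_nhds_zero]
  intro δ hδ
  rcases eq_or_ne δ ⊤ with rfl | hδt
  · simp
  have hδ' : 0 < δ.toReal := ENNReal.toReal_pos hδ.ne' hδt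
  set C' : ℝ := |C| + 1 with hC'
  have hC'0 : 0 < C' := by positivity
  have hCC' : C ≤ C' := (le_abs_self C).trans (by linarith)
  obtain ⟨B₀, hB₀⟩ := exists_nat_ge (4 / δ.toReal)
  -- Beyond `B` one has `log p ≥ 1`, since `3 > e`, and the failure probability `4/p` is at most
  -- `δ`.
  set B : ℕ := max B₀ 3 with hB
  have hB3 : (3 : ℝ) ≤ B := by exact_mod_cast le_max_right B₀ 3
  have hBδ : 4 / δ.toReal ≤ B := hB₀.trans (by exact_mod_cast le_max_left B₀ 3)
  obtain ⟨M, hM0, hM⟩ := NodewiseSqrtLasso.exists_exp_neg_sq_le (b := 4 * (B : ℝ) ^ 2)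
    (c := 64 * K ^ 4) (by positivity) hδ'
  set κ : ℝ := 1 / (10000 * (L ^ 2) ^ 4) with hκ
  have hκ0 : 0 < κ := by positivity
  obtain ⟨a, ha0, ha1, ha2, ha3⟩ : ∃ a : ℝ, 0 < a ∧ 4 * C' * a ≤ κ ∧ C' * a ≤ 16 * K ^ 2 ∧
      240000 * L ^ 22 * C' ^ 2 * a ≤ ε := by
    refine ⟨min (κ / (4 * C')) (min (16 * K ^ 2 / C') (ε / (240000 * L ^ 22 * C' ^ 2))),
      by positivity, ?_, ?_, ?_⟩
    · rw [← le_div_iff₀' (by positivity)]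
      exact min_le_left _ _
    · rw [← le_div_iff₀' (by positivity)]
      exact (min_le_right _ _).trans (min_le_left _ _)
    · rw [← le_div_iff₀' (by positivity)]
      exact (min_le_right _ _).trans (min_le_right _ _)
  -- For `p ≤ B`, `D/√n` bounds `λ` plus the noise, using `log p ≤ p ≤ B`.
  set D : ℝ := C' * √B + 12 * L ^ 6 * M with hD
  filter_upwards [hlam, hT, hd.bound ha0, hlog.bound (pow_pos ha0 2), eventually_gt_atTop 0,
    NodewiseSqrtLasso.eventually_div_sqrt_le (B * D) hκ0,
    NodewiseSqrtLasso.eventually_div_sqrt_le M (y := 16 * K ^ 2) (by positivity),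
    NodewiseSqrtLasso.eventually_div_sqrt_le (30000 * L ^ 22 * B * D ^ 2) hε]
    with n hlamn hTn hdn hlogn hn hD1 hM1 hD2
  have := hP n
  have hn' : (0 : ℝ) < n := by exact_mod_cast hn
  have hlog0 : 0 ≤ Real.log (p n) := Real.log_natCast_nonneg _
  have hlam2 : lam n ≤ C' * √(Real.log (p n) / n) :=
    hlamn.2.trans (mul_le_mul_of_nonneg_right hCC' (Real.sqrt_nonneg _))
  rw [← ENNReal.ofReal_toReal hδt]
  -- The split is made for each `n` separately, as `p` need not be monotone. The values `p ≤ 1`,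
  -- where `log p = 0` and `√n / log p` takes its default value 0, fall in the bounded branch.
  rcases le_or_gt (p n) B with hpB | hpB
  · have hpB' : (p n : ℝ) ≤ B := by exact_mod_cast hpB
    refine (NodewiseSqrtLasso.measure_remainder_le_of_dim (B := B) (M := M) (D := D) (hb n) hL
      (hsg n) hK (hm n) (hX n) (hindep n) hTn hn (by linarith) hpB' hM0
      (le_trans (by positivity) hlamn.1) ?_ (by rwa [← mul_div_assoc]) hM1 hD2).trans
      (ENNReal.ofReal_le_ofReal hM)
    have h1 : √(Real.log (p n) / n) ≤ √B / √n := by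
      rw [Real.sqrt_div hlog0]
      gcongr
      exact (Real.log_le_self (Nat.cast_nonneg _)).trans hpB'
    calc lam n + 12 * L ^ 6 * (M / √n) ≤ C' * (√B / √n) + 12 * L ^ 6 * (M / √n) := by
          gcongr
          exact hlam2.trans (by gcongr)
      _ = D / √n := by rw [hD]; ring
  · have hpB' : (B : ℝ) ≤ p n := by exact_mod_cast hpB.le
    have hp1 : 1 ≤ Real.log (p n) := by
      rw [Real.le_log_iff_exp_le (by linarith)]
      linarith [Real.exp_one_lt_three]
    refine (NodewiseSqrtLasso.measure_remainder_le_of_sparse (hb n) hL (hsg n) hK (hm n) (hX n)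
      (hindep n) hTn hn hp1 hC'0 hlamn.1 hlam2 ha0 ?_ ?_ ha1 ha2 ha3 hε.le).trans
      (ENNReal.ofReal_le_ofReal ?_)
    · rwa [Real.norm_of_nonneg hlog0, Real.norm_of_nonneg hn'.le] at hlogn
    · rw [Real.norm_of_nonneg (Nat.cast_nonneg _), Real.norm_of_nonneg (by positivity),
        ← mul_div_assoc, le_div_iff₀ (by linarith)] at hdn
      exact hdn
    · rw [div_le_iff₀ (by linarith)]
      rw [div_le_iff₀ hδ'] at hBδ
      nlinarith
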